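/- Let $\beta>0$ be a real number and let $d$ be a positive integer, both fixed. For a partition $\lambda$ let $\ell(\lambda)$ be its number of non-zero parts and let $f^\lambda$ be the number of standard Young tableaux of shape $\lambda$. Then, as $n\to\infty$, $$\sum_{\lambda\vdash n,\ \ell(\lambda)\le d}(f^\lambda)^\beta \;\sim\; \Bigl((2\pi)^{-\frac{d-1}{2}}\, d^{\,n+\frac{d^2}{2}}\, n^{-\frac{(d-1)(d+2)}{4}}\Bigr)^{\beta}\, n^{\frac{d-1}{2}}\, Z'_d(\beta),$$ that is, the ratio of the two sides tends to $1$, where $$Z'_d(\beta)=\int_{\mathfrak H_d} e^{-\frac{d\beta}{2}(x_1^2+\cdots+x_d^2)}\prod_{1\le i<j\le d}(x_i-x_j)^\beta\,dx_1\cdots dx_{d-1},$$ $$\mathfrak H_d=\{(x_1,\dots,x_d)\in\mathbb R^d : x_1\ge\cdots\ge x_d,\ x_1+\cdots+x_d=0\},$$ and the integral runs over the $(x_1,\dots,x_{d-1})\in\mathbb R^{d-1}$ such that $(x_1,\dots,x_d)\in\mathfrak H_d$ with $x_d:=-(x_1+\cdots+x_{d-1})$ (for $d=1$ the integral is $1$).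 -/

import Mathlib

/-- A semistandard tableau of shape `μ` is standard if its entries are `1, …, |μ|`, each used
exactly once (so that the weakly increasing rows are in fact strictly increasing). -/
def IsStandardTableau {μ : YoungDiagram} (T : SemistandardYoungTableau μ) : Prop :=
  Set.BijOn (fun c : ℕ × ℕ => T c.1 c.2) (μ.cells : Set (ℕ × ℕ)) (Set.Icc 1 μ.card)

/-- The number `f^μ` of standard Young tableaux of shape `μ`. -/
noncomputable def numStandardTableaux (μ : YoungDiagram) : ℕ :=
  Nat.card {T : SemistandardYoungTableau μ // IsStandardTableau T}

/-- There are finitely many partitions of `n` with at most `d` rows (`μ.colLen 0` is the number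
of non-empty rows of the Young diagram `μ`). -/
theorem finite_partitions (n d : ℕ) :
    {μ : YoungDiagram | μ.card = n ∧ μ.colLen 0 ≤ d}.Finite := by
  refine Set.Finite.of_injOn (f := YoungDiagram.cells)
    (t := (((Finset.range n ×ˢ Finset.range n).powerset : Finset (Finset (ℕ × ℕ))) :
      Set (Finset (ℕ × ℕ)))) ?_ ?_ (Finset.finite_toSet _)
  · rintro μ ⟨hμ, -⟩
    simp only [Finset.coe_powerset, Set.mem_preimage, Set.mem_powerset_iff, Finset.coe_subset]
    rintro ⟨i, j⟩ hc
    rw [YoungDiagram.mem_cells] at hc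
    have h1 : j < μ.rowLen i := YoungDiagram.mem_iff_lt_rowLen.1 hc
    have h2 : i < μ.colLen j := YoungDiagram.mem_iff_lt_colLen.1 hc
    have h3 : μ.rowLen i ≤ μ.card := by
      rw [YoungDiagram.rowLen_eq_card]
      exact Finset.card_le_card (Finset.filter_subset _ _)
    have h4 : μ.colLen j ≤ μ.card := by
      rw [YoungDiagram.colLen_eq_card]
      exact Finset.card_le_card (Finset.filter_subset _ _)
    simp only [Finset.mem_product, Finset.mem_range]
    omega
  · intro μ _ ν _ h
    exact YoungDiagram.ext h

/-- The set `P_n(d)` of partitions of `n` of length at most `d`. -/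
noncomputable def partitionsOfLengthLE (n d : ℕ) : Finset YoungDiagram :=
  (finite_partitions n d).toFinset

/-- The chamber `x_1 ≥ ⋯ ≥ x_d`, `x_1 + ⋯ + x_d = 0`. -/
def tracelessChamber (d : ℕ) : Set (Fin d → ℝ) :=
  {x | Antitone x ∧ ∑ i, x i = 0}

/-- The point `(x_1, …, x_{d-1}, x_d)` with `x_d = -(x_1 + ⋯ + x_{d-1})`. -/
def tracelessPoint (d : ℕ) (x : Fin (d - 1) → ℝ) : Fin d → ℝ :=
  fun i => if h : i.1 < d - 1 then x ⟨i.1, h⟩ else -∑ k, x k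

/-- The function `exp(-(dβ/2) ∑ x_i²) ∏_{i<j} (x_i - x_j)^β`. -/
noncomputable def chamberDensity (d : ℕ) (β : ℝ) (x : Fin d → ℝ) : ℝ :=
  Real.exp (-((d : ℝ) * β / 2) * ∑ i, x i ^ 2) * ∏ i, ∏ j ∈ Finset.Ioi i, (x i - x j) ^ β

/-- The integral `Z'_d(β)` of `chamberDensity` over the traceless chamber, with respect to
`dx_1 ⋯ dx_{d-1}`. -/
noncomputable def chamberIntegral (d : ℕ) (β : ℝ) : ℝ :=
  ∫ x in {x : Fin (d - 1) → ℝ | tracelessPoint d x ∈ tracelessChamber d},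
    chamberDensity d β (tracelessPoint d x)

/-! Put `l_i = λ_i + d - i`. The Frobenius–Young formula gives `f^λ = n! ∏_{i<j} (l_i - l_j) / ∏
l_i!`. Since `∑ l_i` depends only on `n` and `d`, the product `∏ 1 / l_i!` is, up to a factor
depending only on `n` and `d`, a product of Poisson weights of mean `n / d`. With `x_i = (l_i - n /
d) / √n`, the local limit theorem turns these weights into `exp(-(d / 2) ∑ x_i²)`, and the
differences become `∏ (x_i - x_j)` times a power of `√n`. So `f^λ` is exactly `growthFactor` times
`normalizedCount` (`numStandardTableaux_eq`), and the second factor converges to the density for `β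
= 1` (`tendsto_normalizedCount`).

The sum of `β`-th powers is then a Riemann sum. For `d = m + 1`, partitions correspond to disjoint
cubes of side `1 / √n` in the first `m` coordinates, which accounts for the factor `n^(m/2)`. The
resulting step function converges at every point (`tendsto_stepDensity`). The region is unbounded,
so dominated convergence needs an exponential bound uniform in `n` (`exists_norm_stepDensity_le`);
it comes from exponential tilting of the Poisson weights. The limit integral is positive, so
convergence is asymptotic equivalence.

The Frobenius–Young formula follows by induction on `n`: the left side obeys the branching rule, and
the right side obeys the same recursion by `sum_mul_diffProd_update`, a Vandermonde identity in the
basis of falling factorials. -/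

/-! ### Corners and row lengths of Young diagrams -/

/-- A cell of a Young diagram is a corner if neither the cell below nor the one to its right
belongs to the diagram. -/
def YoungDiagram.IsCorner (μ : YoungDiagram) (c : ℕ × ℕ) : Prop :=
  c ∈ μ ∧ (c.1 + 1, c.2) ∉ μ ∧ (c.1, c.2 + 1) ∉ μ

namespace YoungDiagram

variable {μ : YoungDiagram} {c : ℕ × ℕ}

theorem IsCorner.eq_of_le (hc : μ.IsCorner c) {i j : ℕ} (hi : c.1 ≤ i) (hj : c.2 ≤ j)
    (h : (i, j) ∈ μ) : (i, j) = c := by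
  rcases hi.eq_or_lt with rfl | hi
  · rcases hj.eq_or_lt with rfl | hj
    · rfl
    · exact absurd (μ.up_left_mem le_rfl hj h) hc.2.2
  · exact absurd (μ.up_left_mem hi hj h) hc.2.1

/-- The Young diagram obtained by removing a corner. -/
def removeCorner (μ : YoungDiagram) (c : ℕ × ℕ) (hc : μ.IsCorner c) : YoungDiagram where
  cells := μ.cells.erase c
  isLowerSet := by
    rintro ⟨i₂, j₂⟩ ⟨i₁, j₁⟩ ⟨hi : i₁ ≤ i₂, hj : j₁ ≤ j₂⟩ h
    simp only [Finset.coe_erase, Set.mem_sdiff, Finset.mem_coe, mem_cells,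
      Set.mem_singleton_iff] at h ⊢
    refine ⟨μ.up_left_mem hi hj h.1, ?_⟩
    rintro rfl
    exact h.2 (hc.eq_of_le hi hj h.1)

theorem mem_removeCorner (hc : μ.IsCorner c) {x : ℕ × ℕ} :
    x ∈ μ.removeCorner c hc ↔ x ≠ c ∧ x ∈ μ := by
  rw [← mem_cells, removeCorner, Finset.mem_erase, mem_cells]

theorem card_removeCorner (hc : μ.IsCorner c) : (μ.removeCorner c hc).card + 1 = μ.card :=
  Finset.card_erase_add_one ((mem_cells c).2 hc.1)

theorem rowLen_removeCorner (hc : μ.IsCorner c) (i : ℕ) :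
    (μ.removeCorner c hc).rowLen i = if i = c.1 then μ.rowLen i - 1 else μ.rowLen i := by
  refine eq_of_forall_lt_iff fun j => ?_
  rw [← mem_iff_lt_rowLen, mem_removeCorner, mem_iff_lt_rowLen]
  obtain ⟨a, b⟩ := c
  have h1 := mem_iff_lt_rowLen.1 hc.1
  have h2 := mt mem_iff_lt_rowLen.2 hc.2.2
  simp only [Ne, Prod.mk.injEq] at *
  split_ifs with h
  · subst h; omega
  · omega

theorem isCorner_iff {i j : ℕ} :
    μ.IsCorner (i, j) ↔ μ.rowLen (i + 1) < μ.rowLen i ∧ j = μ.rowLen i - 1 := by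
  have := μ.rowLen_anti i (i + 1) (by omega)
  simp only [IsCorner, mem_iff_lt_rowLen]
  omega

theorem colLen_zero_le_iff {d : ℕ} : μ.colLen 0 ≤ d ↔ μ.rowLen d = 0 := by
  have h : (d, 0) ∈ μ ↔ d < μ.colLen 0 := mem_iff_lt_colLen
  rw [mem_iff_lt_rowLen] at h
  omega

theorem card_eq_sum_rowLen {d : ℕ} (hd : μ.colLen 0 ≤ d) :
    μ.card = ∑ i : Fin d, μ.rowLen i := by
  rw [YoungDiagram.card, Finset.card_eq_sum_card_fiberwise (f := Prod.fst) (t := Finset.range d),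
    Finset.sum_range]
  · refine Finset.sum_congr rfl fun i _ => ?_
    rw [rowLen_eq_card, row]
  · rintro ⟨i, j⟩ h
    have h1 := mem_iff_lt_colLen.1 (μ.up_left_mem le_rfl (Nat.zero_le j) ((mem_cells _).1 h))
    simp only [Finset.coe_range, Set.mem_Iio]
    omega

end YoungDiagram

/-! ### The branching rule for standard tableaux -/

section Branching

variable {μ : YoungDiagram}

theorem finite_standardTableaux (μ : YoungDiagram) :
    Finite {T : SemistandardYoungTableau μ // IsStandardTableau T} := by
  refine Finite.of_injective (β := μ.cells → Set.Icc 1 μ.card)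
    (fun T c => ⟨T.1 c.1.1 c.1.2, T.2.mapsTo c.2⟩) ?_
  intro T T' h
  refine Subtype.ext (SemistandardYoungTableau.ext fun i j => ?_)
  by_cases hc : (i, j) ∈ μ
  · exact congrArg Subtype.val (congrFun h ⟨(i, j), hc⟩)
  · rw [T.1.zeros hc, T'.1.zeros hc]

/-- Remove the corner `c` from a tableau. -/
def SemistandardYoungTableau.removeCorner {c : ℕ × ℕ} (T : SemistandardYoungTableau μ)
    (hc : μ.IsCorner c) : SemistandardYoungTableau (μ.removeCorner c hc) where
  entry i j := if (i, j) = c then 0 else T i j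
  row_weak' {i j₁ j₂} hj h := by
    rw [YoungDiagram.mem_removeCorner] at h
    rw [if_neg h.1]
    split_ifs
    · exact Nat.zero_le _
    · exact T.row_weak hj h.2
  col_strict' {i₁ i₂ j} hi h := by
    rw [YoungDiagram.mem_removeCorner] at h
    rw [if_neg h.1]
    split_ifs
    · exact (Nat.zero_le _).trans_lt (T.col_strict hi h.2)
    · exact T.col_strict hi h.2
  zeros' {i j} h := by
    rw [YoungDiagram.mem_removeCorner] at h
    split_ifs with h'
    · rfl
    · exact T.zeros fun h'' => h ⟨h', h''⟩

/-- Add the corner `c`, with entry `N`, to a tableau with entries less than `N`. -/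
def SemistandardYoungTableau.addCorner {c : ℕ × ℕ} (hc : μ.IsCorner c)
    (T : SemistandardYoungTableau (μ.removeCorner c hc)) (N : ℕ) (hN : ∀ i j, T i j < N) :
    SemistandardYoungTableau μ where
  entry i j := if (i, j) = c then N else T i j
  row_weak' {i j₁ j₂} hj h := by
    by_cases h₂ : (i, j₂) = c
    · rw [if_pos h₂]
      split_ifs
      · exact le_rfl
      · exact (hN _ _).le
    · have h₁ : (i, j₁) ≠ c := by
        rintro rfl
        exact h₂ (hc.eq_of_le le_rfl hj.le h)
      rw [if_neg h₁, if_neg h₂]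
      exact T.row_weak hj ((YoungDiagram.mem_removeCorner hc).2 ⟨h₂, h⟩)
  col_strict' {i₁ i₂ j} hi h := by
    have h₁ : (i₁, j) ≠ c := by
      rintro rfl
      have := hc.eq_of_le hi.le le_rfl h
      simp only [Prod.mk.injEq, and_true] at this
      omega
    rw [if_neg h₁]
    by_cases h₂ : (i₂, j) = c
    · rw [if_pos h₂]
      exact hN _ _
    · rw [if_neg h₂]
      exact T.col_strict hi ((YoungDiagram.mem_removeCorner hc).2 ⟨h₂, h⟩)
  zeros' {i j} h := by
    have hne : (i, j) ≠ c := by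
      rintro rfl
      exact h hc.1
    rw [if_neg hne]
    exact T.zeros fun h' => h ((YoungDiagram.mem_removeCorner hc).1 h').2

theorem IsStandardTableau.entry_le {T : SemistandardYoungTableau μ} (hT : IsStandardTableau T)
    (i j : ℕ) : T i j ≤ μ.card := by
  by_cases h : (i, j) ∈ μ
  · exact (hT.mapsTo (x := (i, j)) h).2
  · rw [T.zeros h]
    exact Nat.zero_le _

/-- Below the maximal entry strictness of columns fails; to its right the weak inequality would
force a repeated entry, against injectivity. -/
theorem IsStandardTableau.isCorner {T : SemistandardYoungTableau μ} (hT : IsStandardTableau T)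
    {c : ℕ × ℕ} (hc : c ∈ μ) (h : T c.1 c.2 = μ.card) : μ.IsCorner c := by
  refine ⟨hc, fun h' => ?_, fun h' => ?_⟩
  · have := T.col_strict (lt_add_one c.1) h'
    have := hT.entry_le (c.1 + 1) c.2
    omega
  · have h1 := T.row_weak (lt_add_one c.2) h'
    have h2 := hT.entry_le c.1 (c.2 + 1)
    have h3 : c = (c.1, c.2 + 1) := hT.injOn hc h' (le_antisymm h1 (h2.trans h.ge))
    have := congrArg Prod.snd h3
    simp at this

theorem IsStandardTableau.removeCorner {T : SemistandardYoungTableau μ} (hT : IsStandardTableau T)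
    {c : ℕ × ℕ} (hc : μ.IsCorner c) (h : T c.1 c.2 = μ.card) :
    IsStandardTableau (T.removeCorner hc) := by
  have hcard := YoungDiagram.card_removeCorner hc
  have key : ∀ x : ℕ × ℕ, x ≠ c → (T.removeCorner hc) x.1 x.2 = T x.1 x.2 :=
    fun x hx => if_neg hx
  refine ⟨fun x hx => ?_, fun x hx y hy hxy => ?_, fun k hk => ?_⟩
  · have hx := (YoungDiagram.mem_removeCorner hc).1 hx
    have h1 := hT.mapsTo hx.2
    have h2 : T x.1 x.2 ≠ μ.card := fun h' => hx.1 (hT.injOn hx.2 hc.1 (h'.trans h.symm))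
    simp only [key x hx.1, Set.mem_Icc] at h1 ⊢
    omega
  · have hx := (YoungDiagram.mem_removeCorner hc).1 hx
    have hy := (YoungDiagram.mem_removeCorner hc).1 hy
    simp only [key x hx.1, key y hy.1] at hxy
    exact hT.injOn hx.2 hy.2 hxy
  · obtain ⟨x, hx, hxk⟩ := hT.surjOn (show k ∈ Set.Icc 1 μ.card from ⟨hk.1, by have := hk.2; omega⟩)
    have hxc : x ≠ c := by
      rintro rfl
      have := hk.2
      simp only at hxk
      omega
    exact ⟨x, (YoungDiagram.mem_removeCorner hc).2 ⟨hxc, hx⟩, (key x hxc).trans hxk⟩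

theorem IsStandardTableau.addCorner {c : ℕ × ℕ} {hc : μ.IsCorner c}
    {T : SemistandardYoungTableau (μ.removeCorner c hc)} (hT : IsStandardTableau T)
    (hN : ∀ i j, T i j < μ.card) :
    IsStandardTableau (SemistandardYoungTableau.addCorner hc T μ.card hN) := by
  have hcard := YoungDiagram.card_removeCorner hc
  have key : ∀ x : ℕ × ℕ, x ≠ c →
      (SemistandardYoungTableau.addCorner hc T μ.card hN) x.1 x.2 = T x.1 x.2 :=
    fun x hx => if_neg hx
  have keyc : (SemistandardYoungTableau.addCorner hc T μ.card hN) c.1 c.2 = μ.card := if_pos rfl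
  refine ⟨fun x hx => ?_, fun x hx y hy hxy => ?_, fun k hk => ?_⟩
  · by_cases hxc : x = c
    · subst hxc
      simp only [keyc, Set.mem_Icc]
      omega
    · have := hT.mapsTo ((YoungDiagram.mem_removeCorner hc).2 ⟨hxc, hx⟩)
      simp only [key x hxc, Set.mem_Icc] at this ⊢
      omega
  · by_cases hxc : x = c <;> by_cases hyc : y = c
    · rw [hxc, hyc]
    · subst hxc
      simp only [keyc, key y hyc] at hxy
      exact absurd hxy.symm (hN _ _).ne
    · subst hyc
      simp only [keyc, key x hxc] at hxy
      exact absurd hxy (hN _ _).ne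
    · simp only [key x hxc, key y hyc] at hxy
      exact hT.injOn ((YoungDiagram.mem_removeCorner hc).2 ⟨hxc, hx⟩)
        ((YoungDiagram.mem_removeCorner hc).2 ⟨hyc, hy⟩) hxy
  · rcases hk.2.eq_or_lt with h | h
    · exact ⟨c, hc.1, keyc.trans h.symm⟩
    · obtain ⟨x, hx, hxk⟩ := hT.surjOn (show k ∈ Set.Icc 1 _ from ⟨hk.1, by omega⟩)
      have hx := (YoungDiagram.mem_removeCorner hc).1 hx
      exact ⟨x, hx.2, (key x hx.1).trans hxk⟩

/-- Standard tableaux with largest entry at the corner `c` correspond to standard tableaux of the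
diagram without `c`. -/
def standardTableauxCornerEquiv {c : ℕ × ℕ} (hc : μ.IsCorner c) :
    {T : {T : SemistandardYoungTableau μ // IsStandardTableau T} // T.1 c.1 c.2 = μ.card} ≃
      {T : SemistandardYoungTableau (μ.removeCorner c hc) // IsStandardTableau T} where
  toFun T := ⟨T.1.1.removeCorner hc, T.1.2.removeCorner hc T.2⟩
  invFun T :=
    have hN : ∀ i j, T.1 i j < μ.card := fun i j =>
      (T.2.entry_le i j).trans_lt (by have := YoungDiagram.card_removeCorner hc; omega)
    ⟨⟨SemistandardYoungTableau.addCorner hc T.1 μ.card hN, T.2.addCorner hN⟩, if_pos rfl⟩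
  left_inv T := by
    refine Subtype.ext (Subtype.ext (SemistandardYoungTableau.ext fun i j => ?_))
    change (if (i, j) = c then μ.card else if (i, j) = c then 0 else T.1.1 i j) = T.1.1 i j
    split_ifs with h
    · subst h
      exact T.2.symm
    · rfl
  right_inv T := by
    refine Subtype.ext (SemistandardYoungTableau.ext fun i j => ?_)
    change (if (i, j) = c then 0 else if (i, j) = c then μ.card else T.1 i j) = T.1 i j
    split_ifs with h
    · exact (T.1.zeros fun h' => ((YoungDiagram.mem_removeCorner hc).1 h').1 h).symm
    · rfl

open Classical in
-- Tableaux are sorted by the cell holding the largest entry, which is unique and a corner.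
theorem numStandardTableaux_eq_sum_cells (hμ : 0 < μ.card) :
    numStandardTableaux μ = ∑ c ∈ μ.cells,
      if hc : μ.IsCorner c then numStandardTableaux (μ.removeCorner c hc) else 0 := by
  have := finite_standardTableaux μ
  have e : {T : SemistandardYoungTableau μ // IsStandardTableau T} ≃ Σ c : μ.cells,
      {T : {T : SemistandardYoungTableau μ // IsStandardTableau T} //
        T.1 c.1.1 c.1.2 = μ.card} :=
    { toFun := fun T =>
        have h := T.2.surjOn (show μ.card ∈ Set.Icc 1 μ.card from ⟨hμ, le_rfl⟩)
        ⟨⟨h.choose, h.choose_spec.1⟩, ⟨T, h.choose_spec.2⟩⟩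
      invFun := fun x => x.2.1
      left_inv := fun T => rfl
      right_inv := by
        rintro ⟨⟨c, hc⟩, ⟨T, hT⟩⟩
        have h := T.2.surjOn (show μ.card ∈ Set.Icc 1 μ.card from ⟨hμ, le_rfl⟩)
        have h' : h.choose = c :=
          T.2.injOn h.choose_spec.1 hc (h.choose_spec.2.trans hT.symm)
        refine Sigma.ext (Subtype.ext h') ?_
        rw [Subtype.heq_iff_coe_eq]
        intro x
        simp only [h'] }
  rw [numStandardTableaux, Nat.card_congr e, Nat.card_sigma, ← Finset.sum_coe_sort μ.cells]
  refine Finset.sum_congr rfl fun c _ => ?_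
  split_ifs with hc
  · exact Nat.card_congr (standardTableauxCornerEquiv hc)
  · have : IsEmpty {T : {T : SemistandardYoungTableau μ // IsStandardTableau T} //
        T.1 c.1.1 c.1.2 = μ.card} := ⟨fun T => hc (T.1.2.isCorner c.2 T.2)⟩
    exact Nat.card_of_isEmpty

theorem YoungDiagram.isCorner_of_rowLen_lt {i : ℕ} (h : μ.rowLen (i + 1) < μ.rowLen i) :
    μ.IsCorner (i, μ.rowLen i - 1) :=
  YoungDiagram.isCorner_iff.2 ⟨h, rfl⟩

/-- The branching rule. -/
theorem numStandardTableaux_eq_sum_rows {d : ℕ} (hμ : 0 < μ.card) (hd : μ.colLen 0 ≤ d) :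
    numStandardTableaux μ = ∑ i : Fin d, if h : μ.rowLen (i + 1) < μ.rowLen i then
      numStandardTableaux (μ.removeCorner _ (YoungDiagram.isCorner_of_rowLen_lt h)) else 0 := by
  classical
  rw [numStandardTableaux_eq_sum_cells hμ]
  symm
  refine Finset.sum_bij_ne_zero (fun i _ _ => ((i : ℕ), μ.rowLen i - 1)) ?_ ?_ ?_ ?_
  · intro i _ h
    have h' : μ.rowLen (i + 1) < μ.rowLen i := by
      by_contra h'
      exact h (dif_neg h')
    exact (YoungDiagram.isCorner_of_rowLen_lt h').1
  · intro i _ _ j _ _ h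
    exact Fin.ext (congrArg Prod.fst h)
  · rintro ⟨i, j⟩ hc h
    have hcor : μ.IsCorner (i, j) := by
      by_contra h'
      exact h (dif_neg h')
    have h' := YoungDiagram.isCorner_iff.1 hcor
    have hi : i < d := by
      have := YoungDiagram.mem_iff_lt_colLen.1
        (μ.up_left_mem le_rfl (Nat.zero_le j) ((YoungDiagram.mem_cells _).1 hc))
      omega
    obtain ⟨h1, rfl⟩ := h'
    refine ⟨⟨i, hi⟩, Finset.mem_univ _, ?_, rfl⟩
    rw [dif_pos hcor] at h
    rwa [dif_pos h1]
  · intro i _ h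
    have h' : μ.rowLen (i + 1) < μ.rowLen i := by
      by_contra h'
      exact h (dif_neg h')
    rw [dif_pos h', dif_pos (YoungDiagram.isCorner_of_rowLen_lt h')]

end Branching

/-! ### The Frobenius–Young formula -/

/-- In the Leibniz expansion the term of `σ` is multiplied by `∑ i, (a i - b (σ i))`, which does not
depend on `σ`. -/
theorem Matrix.sum_det_updateCol_sub_mul {d : ℕ} {R : Type*} [CommRing R]
    (M : Matrix (Fin d) (Fin d) R) (a b : Fin d → R) :
    ∑ i, (M.updateCol i fun j => (a i - b j) * M j i).det = (∑ i, a i - ∑ j, b j) * M.det := by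
  simp only [Matrix.det_apply]
  rw [Finset.sum_comm, Finset.mul_sum]
  refine Finset.sum_congr rfl fun σ _ => ?_
  rw [← Finset.smul_sum, mul_smul_comm]
  congr 1
  rw [← Equiv.sum_comp σ b, ← Finset.sum_sub_distrib, Finset.sum_mul]
  refine Finset.sum_congr rfl fun i _ => ?_
  rw [← Finset.mul_prod_erase _ _ (Finset.mem_univ i),
    ← Finset.mul_prod_erase Finset.univ (fun k => M (σ k) k) (Finset.mem_univ i),
    Matrix.updateCol_self, mul_assoc]
  congr 2
  refine Finset.prod_congr rfl fun k hk => ?_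
  rw [Matrix.updateCol_ne (Finset.ne_of_mem_erase hk)]

/-- The product of the differences `v i - v j`, `i < j`. -/
noncomputable def diffProd {d : ℕ} (v : Fin d → ℝ) : ℝ :=
  ∏ i, ∏ j ∈ Finset.Ioi i, (v i - v j)

/-- Falling factorials are monic of degree `j`, so their determinant is the Vandermonde one; the
signs reverse its differences `v j - v i`. -/
theorem diffProd_eq_det {d : ℕ} (v : Fin d → ℝ) :
    diffProd v = (∏ i : Fin d, ∏ _j ∈ Finset.Ioi i, (-1 : ℝ)) *
      (Matrix.of fun j i : Fin d => (descPochhammer ℝ j).eval (v i)).det := by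
  have h := Matrix.det_eval_matrixOfPolynomials_eq_det_vandermonde v
    (fun i => descPochhammer ℝ i) (fun i => descPochhammer_natDegree ℝ i)
    (fun i => monic_descPochhammer ℝ i)
  rw [← Matrix.det_transpose, show (Matrix.of fun j i : Fin d =>
    (descPochhammer ℝ j).eval (v i)).transpose =
      Matrix.of fun i j : Fin d => (descPochhammer ℝ j).eval (v i) from rfl, ← h,
    Matrix.det_vandermonde, ← Finset.prod_mul_distrib, diffProd]
  refine Finset.prod_congr rfl fun i _ => ?_
  rw [← Finset.prod_mul_distrib]
  exact Finset.prod_congr rfl fun j _ => by ring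

/-- Write `(x)_j` for the falling factorial. Since `x (x-1)_j = (x)_{j+1} = (x - j) (x)_j`, lowering
`v i` by one and multiplying by `v i` scales the entries of column `i` by `v i - j`, the situation
of `Matrix.sum_det_updateCol_sub_mul`. -/
theorem sum_mul_diffProd_update {d : ℕ} (v : Fin d → ℝ) :
    ∑ i, v i * diffProd (Function.update v i (v i - 1)) =
      (∑ i, v i - ∑ j : Fin d, (j : ℝ)) * diffProd v := by
  simp only [diffProd_eq_det]
  rw [mul_left_comm, ← Matrix.sum_det_updateCol_sub_mul, Finset.mul_sum]
  refine Finset.sum_congr rfl fun i _ => ?_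
  rw [mul_left_comm]
  congr 1
  rw [show (Matrix.of fun j k : Fin d => (descPochhammer ℝ j).eval
      (Function.update v i (v i - 1) k)) = (Matrix.of fun j k : Fin d =>
        (descPochhammer ℝ j).eval (v k)).updateCol i
          (fun j => (descPochhammer ℝ j).eval (v i - 1)) from ?_, ← Matrix.det_updateCol_smul]
  · congr 2
    ext j
    have h1 := congrArg (Polynomial.eval (v i)) (descPochhammer_succ_left ℝ j)
    rw [descPochhammer_succ_eval] at h1
    simp only [Polynomial.eval_mul, Polynomial.eval_X, Polynomial.eval_comp, Polynomial.eval_sub,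
      Polynomial.eval_one] at h1
    simp only [Pi.smul_apply, smul_eq_mul, Matrix.of_apply]
    rw [← h1, mul_comm]
  · ext j k
    by_cases h : k = i
    · subst h
      simp
    · simp [h]

theorem diffProd_eq_zero {d : ℕ} {v : Fin d → ℝ} {i j : Fin d} (hij : i < j) (h : v i = v j) :
    diffProd v = 0 :=
  Finset.prod_eq_zero (Finset.mem_univ i)
    (Finset.prod_eq_zero (Finset.mem_Ioi.2 hij) (sub_eq_zero.2 h))

/-- The base case of the induction: these are the shifted row lengths of the empty diagram. -/
theorem diffProd_staircase (d : ℕ) :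
    diffProd (fun i : Fin d => ((d - 1 - i : ℕ) : ℝ)) =
      ∏ i : Fin d, ((d - 1 - i : ℕ).factorial : ℝ) := by
  induction d with
  | zero => simp [diffProd]
  | succ d ih =>
    rw [Fin.prod_univ_succ, diffProd, Fin.prod_univ_succ, Fin.prod_Ioi_zero]
    congr 1
    · rw [show d + 1 - 1 - ((0 : Fin (d + 1)) : ℕ) = d by simp,
        ← Finset.prod_range_add_one_eq_factorial, ← Fin.prod_univ_eq_prod_range]
      push_cast
      refine Finset.prod_congr rfl fun i _ => ?_
      have h : d + 1 - 1 - (i.succ : ℕ) + (i + 1) = d := by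
        simp only [Fin.val_succ]
        omega
      have h' := congrArg (Nat.cast : ℕ → ℝ) h
      push_cast at h'
      linarith
    · have hs : ∀ i : Fin d, d + 1 - 1 - (i.succ : ℕ) = d - 1 - i := fun i => by
        simp only [Fin.val_succ]
        omega
      simp only [Fin.prod_Ioi_succ, hs]
      exact ih

/-- The shifted row lengths `λ_i + d - i` (with `i` counted from `1`). -/
def shiftedRowLen (d : ℕ) (μ : YoungDiagram) (i : Fin d) : ℕ :=
  μ.rowLen i + (d - 1 - i)

theorem sum_shiftedRowLen {d : ℕ} {μ : YoungDiagram} (hd : μ.colLen 0 ≤ d) :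
    ∑ i, (shiftedRowLen d μ i : ℝ) = μ.card + ∑ j : Fin d, (j : ℝ) := by
  rw [YoungDiagram.card_eq_sum_rowLen hd, ← Equiv.sum_comp Fin.revPerm (fun j : Fin d => (j : ℝ))]
  push_cast
  rw [← Finset.sum_add_distrib]
  refine Finset.sum_congr rfl fun i _ => ?_
  rw [shiftedRowLen, Fin.revPerm_apply, Fin.val_rev]
  rw [Nat.cast_add, show d - 1 - (i : ℕ) = d - (i + 1) by omega]

theorem numStandardTableaux_of_card_eq_zero {μ : YoungDiagram} (hμ : μ.card = 0) :
    numStandardTableaux μ = 1 := by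
  have h : ∀ c, c ∉ μ := fun c hc => by
    rw [YoungDiagram.card, Finset.card_eq_zero] at hμ
    have := (YoungDiagram.mem_cells c).2 hc
    simp [hμ] at this
  rw [numStandardTableaux, Nat.card_eq_one_iff_unique]
  refine ⟨⟨fun T T' => Subtype.ext (SemistandardYoungTableau.ext fun i j => ?_)⟩,
    ⟨⟨default, ?_⟩⟩⟩
  · rw [T.1.zeros (h _), T'.1.zeros (h _)]
  · refine ⟨fun c hc => absurd hc (h c), fun c hc => absurd hc (h c), fun k hk => ?_⟩
    have h1 := hk.1
    have h2 := hk.2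
    omega

/-- The formula of Frobenius and Young for the number of standard tableaux. -/
theorem numStandardTableaux_mul_prod_factorial {d : ℕ} (μ : YoungDiagram) (hd : μ.colLen 0 ≤ d) :
    (numStandardTableaux μ : ℝ) * ∏ i, ((shiftedRowLen d μ i).factorial : ℝ) =
      μ.card.factorial * diffProd (fun i => (shiftedRowLen d μ i : ℝ)) := by
  induction hN : μ.card generalizing μ with
  | zero =>
    have h : ∀ i, shiftedRowLen d μ i = d - 1 - i := fun i => by
      have h1 := YoungDiagram.card_eq_sum_rowLen hd
      have h2 := (Finset.sum_eq_zero_iff.1 (h1.symm.trans hN)) i (Finset.mem_univ i)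
      rw [shiftedRowLen, h2, zero_add]
    simp only [h, numStandardTableaux_of_card_eq_zero hN, diffProd_staircase]
    simp
  | succ N ih =>
    have hterm : ∀ i : Fin d, (((if h : μ.rowLen (i + 1) < μ.rowLen i then numStandardTableaux
          (μ.removeCorner _ (YoungDiagram.isCorner_of_rowLen_lt h)) else 0 : ℕ) : ℝ) *
          ∏ i, ((shiftedRowLen d μ i).factorial : ℝ)) =
        N.factorial * (shiftedRowLen d μ i * diffProd (Function.update
          (fun i => (shiftedRowLen d μ i : ℝ)) i (shiftedRowLen d μ i - 1))) := by
      intro i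
      split_ifs with h
      · have hc := YoungDiagram.isCorner_of_rowLen_lt h
        have hcard := YoungDiagram.card_removeCorner hc
        have hrow := YoungDiagram.rowLen_removeCorner hc
        set ν := μ.removeCorner _ hc with hν
        have hνd : ν.colLen 0 ≤ d := by
          rw [YoungDiagram.colLen_zero_le_iff] at hd ⊢
          rw [hrow]
          split_ifs <;> omega
        have hsi : shiftedRowLen d ν i + 1 = shiftedRowLen d μ i := by
          simp only [shiftedRowLen, hrow, if_true]
          omega
        have hsj : ∀ j, j ≠ i → shiftedRowLen d ν j = shiftedRowLen d μ j := fun j hj => by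
          have : (j : ℕ) ≠ i := fun h => hj (Fin.ext h)
          simp only [shiftedRowLen, hrow, if_neg this]
        have hfun : Function.update (fun i => (shiftedRowLen d μ i : ℝ)) i
            (shiftedRowLen d μ i - 1) = fun j => (shiftedRowLen d ν j : ℝ) := by
          funext j
          by_cases hj : j = i
          · subst hj
            rw [Function.update_self, ← hsi]
            push_cast
            ring
          · rw [Function.update_of_ne hj, hsj j hj]
        have hprod : ∏ j, ((shiftedRowLen d μ j).factorial : ℝ) =
            shiftedRowLen d μ i * ∏ j, ((shiftedRowLen d ν j).factorial : ℝ) := by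
          rw [← Finset.mul_prod_erase _ _ (Finset.mem_univ i),
            ← Finset.mul_prod_erase Finset.univ (fun j => ((shiftedRowLen d ν j).factorial : ℝ))
              (Finset.mem_univ i), ← mul_assoc]
          congr 1
          · rw [← hsi, Nat.factorial_succ]
            push_cast
            ring
          · exact Finset.prod_congr rfl fun j hj => by rw [hsj j (Finset.ne_of_mem_erase hj)]
        rw [hfun, hprod, mul_left_comm, ih ν hνd (by omega)]
        ring
      -- A row without a corner contributes zero on the right as well: either lowering `l_i` makes
      -- it equal to `l_{i+1}`, or `i` is the last row and `l_i = 0`.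
      · rw [Nat.cast_zero, zero_mul]
        have hle := μ.rowLen_anti i (i + 1) (by omega)
        by_cases hid : (i : ℕ) + 1 < d
        · rw [diffProd_eq_zero (i := i) (j := ⟨i + 1, hid⟩) (Fin.mk_lt_mk.2 (Nat.lt_succ_self _))]
          · simp
          · have hne : (⟨i + 1, hid⟩ : Fin d) ≠ i := fun h => by
              have := congrArg Fin.val h
              simp at this
            rw [Function.update_self, Function.update_of_ne hne]
            have : shiftedRowLen d μ i = shiftedRowLen d μ ⟨i + 1, hid⟩ + 1 := by
              simp only [shiftedRowLen]
              omega
            rw [this]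
            push_cast
            ring
        · have h0 : shiftedRowLen d μ i = 0 := by
            have h1 := YoungDiagram.colLen_zero_le_iff.1 hd
            have h2 : (i : ℕ) + 1 = d := by omega
            rw [h2] at h
            simp only [shiftedRowLen]
            omega
          rw [h0]
          simp
    rw [numStandardTableaux_eq_sum_rows (by omega) hd, Nat.cast_sum, Finset.sum_mul,
      Finset.sum_congr rfl fun i _ => hterm i, ← Finset.mul_sum,
      sum_mul_diffProd_update (fun i => (shiftedRowLen d μ i : ℝ)), sum_shiftedRowLen hd, hN,
      Nat.factorial_succ]
    push_cast
    ring

/-! ### Poisson weights: tail bounds and the local limit theorem -/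

open Filter Topology MeasureTheory

/-- The Poisson weight `e^{-a} a^l / l!`. -/
noncomputable def poissonWeight (a : ℝ) (l : ℕ) : ℝ :=
  Real.exp (-a) * a ^ l / l.factorial

theorem poissonWeight_nonneg {a : ℝ} (ha : 0 ≤ a) (l : ℕ) : 0 ≤ poissonWeight a l := by
  unfold poissonWeight
  positivity

theorem poissonWeight_le_one {a : ℝ} (ha : 0 ≤ a) (l : ℕ) : poissonWeight a l ≤ 1 := by
  have h := Real.pow_div_factorial_le_exp a ha l
  rw [poissonWeight, mul_div_assoc]
  calc Real.exp (-a) * (a ^ l / l.factorial) ≤ Real.exp (-a) * Real.exp a := by gcongr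
    _ = 1 := by rw [← Real.exp_add]; simp

theorem poissonWeight_le_succ {a : ℝ} {l : ℕ} (h : (l : ℝ) + 1 ≤ a) :
    poissonWeight a l ≤ poissonWeight a (l + 1) := by
  have hl : (0 : ℝ) < l + 1 := by positivity
  have ha : 0 ≤ a := hl.le.trans h
  have : poissonWeight a (l + 1) = poissonWeight a l * (a / (l + 1)) := by
    rw [poissonWeight, poissonWeight, Nat.factorial_succ, pow_succ]
    push_cast
    field_simp
  rw [this]
  exact le_mul_of_one_le_right (poissonWeight_nonneg ha l) ((one_le_div hl).2 h)

/-- As a function of `a` the weight is largest at `a = l`, by `x ≤ exp (x - 1)` with `x = a / l`;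
there Stirling's lower bound for `l!` applies. -/
theorem sqrt_mul_poissonWeight_le_one {a : ℝ} (ha : 0 ≤ a) {l : ℕ} (hl : l ≠ 0) :
    √(2 * Real.pi * l) * poissonWeight a l ≤ 1 := by
  have hl' : (0 : ℝ) < l := by positivity
  have h1 : a / l ≤ Real.exp (a / l - 1) := by
    have := Real.add_one_le_exp (a / l - 1)
    linarith
  have h2 : (a / l) ^ l ≤ Real.exp (a - l) := by
    calc (a / l) ^ l ≤ Real.exp (a / l - 1) ^ l := by gcongr
      _ = Real.exp (a - l) := by
        rw [← Real.exp_nat_mul]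
        congr 1
        field_simp
  have h3 := Stirling.le_factorial_stirling l
  rw [poissonWeight, mul_div_assoc', div_le_one (by positivity)]
  refine le_trans ?_ h3
  gcongr
  calc Real.exp (-a) * a ^ l = Real.exp (-a) * ((a / l) ^ l * l ^ l) := by
        rw [div_pow]
        field_simp
    _ ≤ Real.exp (-a) * (Real.exp (a - l) * l ^ l) := by gcongr
    _ = (l / Real.exp 1) ^ l := by
        rw [div_pow, ← Real.exp_nat_mul, mul_one, ← mul_assoc, ← Real.exp_add,
          show -a + (a - l) = -(l : ℝ) by ring, Real.exp_neg]
        field_simp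

/-- For `a ≥ 1` and `l ≥ ⌊a⌋` one has `a ≤ 2πl`, so the previous bound suffices. For smaller `l` the
weights increase up to `⌊a⌋`. -/
theorem sqrt_param_mul_poissonWeight_le_one {a : ℝ} (ha : 0 ≤ a) (l : ℕ) :
    √a * poissonWeight a l ≤ 1 := by
  rcases le_total a 1 with h1 | h1
  · exact mul_le_one₀ (Real.sqrt_le_one.2 h1) (poissonWeight_nonneg ha l) (poissonWeight_le_one ha l)
  have hlarge : ∀ k : ℕ, ⌊a⌋₊ ≤ k → √a * poissonWeight a k ≤ 1 := fun k hk => by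
    have hfl : 1 ≤ ⌊a⌋₊ := Nat.one_le_floor_iff _ |>.2 h1
    have hk1 : (1 : ℝ) ≤ k := by exact_mod_cast hfl.trans hk
    have hak : a ≤ 2 * Real.pi * k := by
      have h2 : a < ⌊a⌋₊ + 1 := Nat.lt_floor_add_one a
      have h3 : (⌊a⌋₊ : ℝ) ≤ k := by exact_mod_cast hk
      have h4 : 2 * 1 * (k : ℝ) ≤ 2 * Real.pi * k := by
        gcongr
        linarith [Real.pi_gt_three]
      linarith
    refine le_trans ?_ (sqrt_mul_poissonWeight_le_one ha (l := k) (by omega))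
    exact mul_le_mul_of_nonneg_right (Real.sqrt_le_sqrt hak) (poissonWeight_nonneg ha k)
  rcases le_total ⌊a⌋₊ l with h | h
  · exact hlarge l h
  · refine le_trans ?_ (hlarge _ le_rfl)
    refine mul_le_mul_of_nonneg_left ?_ (Real.sqrt_nonneg a)
    have : ∀ k, l ≤ k → k ≤ ⌊a⌋₊ → poissonWeight a l ≤ poissonWeight a k := by
      intro k hk
      induction k, hk using Nat.le_induction with
      | base => exact fun _ => le_rfl
      | succ k hk ih =>
        intro hka
        refine (ih (by omega)).trans (poissonWeight_le_succ ?_)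
        exact_mod_cast (Nat.le_floor_iff ha).1 hka
    exact this _ h le_rfl

/-- Exponential tilting: it replaces the mean `a` by `a * exp s`. -/
theorem poissonWeight_mul_exp (a s : ℝ) (l : ℕ) :
    poissonWeight a l * Real.exp (s * (l - a)) =
      poissonWeight (a * Real.exp s) l * Real.exp (a * (Real.exp s - 1 - s)) := by
  rw [poissonWeight, poissonWeight, mul_pow, ← Real.exp_nat_mul]
  have : Real.exp (-a) * Real.exp (s * (l - a)) =
      Real.exp (-(a * Real.exp s)) * Real.exp (l * s) * Real.exp (a * (Real.exp s - 1 - s)) := by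
    rw [← Real.exp_add, ← Real.exp_add, ← Real.exp_add]
    congr 1
    ring
  linear_combination a ^ l / l.factorial * this

/-- One factor `e` pays for replacing `√a` by `√(a * exp s)`, the other bounds `exp (a * (exp s - 1
- s))`, whose exponent is at most `a * s ^ 2`. -/
theorem sqrt_mul_poissonWeight_mul_exp_le {a s : ℝ} (ha : 0 ≤ a) (hs : |s| ≤ 1)
    (has : a * s ^ 2 ≤ 1) (l : ℕ) :
    √a * (poissonWeight a l * Real.exp (s * (l - a))) ≤ Real.exp 2 := by
  rw [poissonWeight_mul_exp]
  have h1 := sqrt_param_mul_poissonWeight_le_one (a := a * Real.exp s) (by positivity) l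
  have h2 : a * (Real.exp s - 1 - s) ≤ 1 := by
    have := (abs_le.1 (Real.abs_exp_sub_one_sub_id_le hs)).2
    exact (mul_le_mul_of_nonneg_left this ha).trans has
  have h3 : √a ≤ Real.exp 1 * √(a * Real.exp s) := by
    rw [Real.sqrt_le_iff]
    refine ⟨by positivity, ?_⟩
    rw [mul_pow, Real.sq_sqrt (by positivity), mul_left_comm, ← Real.exp_nat_mul, ← Real.exp_add]
    refine le_mul_of_one_le_right ha (Real.one_le_exp ?_)
    have := (abs_le.1 hs).1
    push_cast
    linarith
  calc _ = √a * poissonWeight (a * Real.exp s) l * Real.exp (a * (Real.exp s - 1 - s)) := by ring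
    _ ≤ (Real.exp 1 * √(a * Real.exp s)) * poissonWeight (a * Real.exp s) l * Real.exp 1 := by
        have := poissonWeight_nonneg (a := a * Real.exp s) (by positivity) l
        gcongr
    _ = Real.exp 2 * (√(a * Real.exp s) * poissonWeight (a * Real.exp s) l) := by
        rw [show (2 : ℝ) = 1 + 1 by norm_num, Real.exp_add]
        ring
    _ ≤ Real.exp 2 * 1 := by gcongr
    _ = _ := mul_one _

theorem sqrt_mul_poissonWeight_le {a : ℝ} (ha : 1 ≤ a) (l : ℕ) :
    √a * poissonWeight a l ≤ Real.exp 2 * Real.exp (-(|l - a| / √a)) := by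
  have ha0 : 0 < a := one_pos.trans_le ha
  have hsq : 1 ≤ √a := Real.one_le_sqrt.2 ha
  have hsq0 : 0 < √a := one_pos.trans_le hsq
  -- The tilt `s` is `1 / √a` with the sign of `l - a`, the largest size allowed by `a * s ^ 2 ≤ 1`.
  have key : ∃ s : ℝ, |s| = 1 / √a ∧ s * (l - a) = |l - a| / √a := by
    rcases le_total 0 ((l : ℝ) - a) with h | h
    · exact ⟨1 / √a, abs_of_pos (by positivity), by rw [abs_of_nonneg h]; ring⟩
    · refine ⟨-(1 / √a), ?_, by rw [abs_of_nonpos h]; ring⟩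
      rw [abs_neg, abs_of_pos (by positivity)]
  obtain ⟨s, hs, hsl⟩ := key
  have h := sqrt_mul_poissonWeight_mul_exp_le (s := s) ha0.le ?_ ?_ l
  · rw [hsl] at h
    rw [Real.exp_neg, ← div_eq_mul_inv, le_div_iff₀ (Real.exp_pos _), mul_assoc]
    exact h
  · rw [hs, div_le_one hsq0]
    exact hsq
  · rw [← sq_abs, hs, div_pow, Real.sq_sqrt ha0.le]
    field_simp
    exact le_rfl

/-- With `log (1 + y) = y - y²/2 + r` and `|r| ≤ 2|y|³`, the error is `-y³/2 + (1 + y) r`. -/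
theorem abs_one_add_mul_log_sub_le {y : ℝ} (hy : |y| ≤ 1 / 2) :
    |(1 + y) * Real.log (1 + y) - y - y ^ 2 / 2| ≤ 5 * |y| ^ 3 := by
  have h := Real.abs_log_sub_add_sum_range_le (x := -y) (by rw [abs_neg]; linarith) 2
  simp only [Finset.sum_range_succ, Finset.sum_range_zero, abs_neg, sub_neg_eq_add] at h
  norm_num at h
  set r := -y + y ^ 2 / 2 + Real.log (1 + y) with hr
  have hr' : |r| ≤ 2 * |y| ^ 3 := by
    refine h.trans ?_
    rw [div_le_iff₀ (by linarith)]
    nlinarith [pow_nonneg (abs_nonneg y) 3]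
  have e : (1 + y) * Real.log (1 + y) - y - y ^ 2 / 2 = -(y ^ 3 / 2) + (1 + y) * r := by
    rw [hr]
    ring
  rw [e]
  have h1 : |1 + y| ≤ 2 := by
    rw [abs_le] at *
    constructor <;> linarith
  calc _ ≤ |-(y ^ 3 / 2)| + |(1 + y) * r| := abs_add_le _ _
    _ = |y| ^ 3 / 2 + |1 + y| * |r| := by
        rw [abs_neg, abs_div, abs_pow, abs_mul, abs_two]
    _ ≤ |y| ^ 3 / 2 + 2 * (2 * |y| ^ 3) := by gcongr
    _ ≤ _ := by nlinarith [pow_nonneg (abs_nonneg y) 3]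

/-- The local limit theorem for the Poisson distribution. -/
theorem tendsto_sqrt_mul_poissonWeight {ι : Type*} {f : Filter ι} {a : ι → ℝ} {l : ι → ℕ} {t : ℝ}
    (ha : Tendsto a f atTop) (hl : Tendsto (fun n => (l n - a n) / √(a n)) f (𝓝 t)) :
    Tendsto (fun n => √(2 * Real.pi * a n) * poissonWeight (a n) (l n)) f
      (𝓝 (Real.exp (-(t ^ 2 / 2)))) := by
  have hsq : Tendsto (fun n => √(a n)) f atTop := Real.tendsto_sqrt_atTop.comp ha
  have hapos : ∀ᶠ n in f, 0 < a n := ha.eventually_gt_atTop 0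
  set y : ι → ℝ := fun n => (l n - a n) / a n with hy
  have hy0 : Tendsto y f (𝓝 0) := by
    refine (hl.div_atTop hsq).congr' ?_
    filter_upwards [hapos] with n hn
    rw [div_div, Real.mul_self_sqrt hn.le]
  have hay : Tendsto (fun n => a n * y n ^ 2) f (𝓝 (t ^ 2)) := by
    refine (hl.pow 2).congr' ?_
    filter_upwards [hapos] with n hn
    rw [hy, div_pow, Real.sq_sqrt hn.le]
    field_simp
  have hla : Tendsto (fun n => (l n : ℝ) / a n) f (𝓝 1) := by
    have := hy0.const_add 1
    rw [add_zero] at this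
    refine this.congr' ?_
    filter_upwards [hapos] with n hn
    rw [hy]
    field_simp
    ring
  have hlreal : Tendsto (fun n => (l n : ℝ)) f atTop := by
    refine (hla.pos_mul_atTop one_pos ha).congr' ?_
    filter_upwards [hapos] with n hn
    field_simp
  have hlnat : Tendsto l f atTop := tendsto_natCast_atTop_iff.1 hlreal
  have hst : Tendsto (fun n => √(2 * l n * Real.pi) * (l n / Real.exp 1) ^ l n /
      (l n).factorial) f (𝓝 1) := by
    have h := Stirling.factorial_isEquivalent_stirling.symm
    rw [Asymptotics.isEquivalent_iff_tendsto_one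
      (Eventually.of_forall fun n => by positivity)] at h
    exact h.comp hlnat
  -- With `l = a (1 + y)`, Stirling's formula for `l!` leaves this exponential. Its exponent is `-a
  -- y² / 2` up to `5 a |y|³`, where `a y² → t²` and `y → 0`.
  have hexp : Tendsto (fun n => Real.exp (a n * y n - a n * ((1 + y n) * Real.log (1 + y n)))) f
      (𝓝 (Real.exp (-(t ^ 2 / 2)))) := by
    refine (Real.continuous_exp.tendsto _).comp ?_
    have h1 : Tendsto (fun n => a n * ((1 + y n) * Real.log (1 + y n) - y n - y n ^ 2 / 2)) f
        (𝓝 0) := by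
      have h2 : Tendsto (fun n => 5 * ((a n * y n ^ 2) * |y n|)) f (𝓝 0) := by
        simpa using (hay.mul hy0.abs).const_mul 5
      refine squeeze_zero_norm' ?_ h2
      filter_upwards [hapos, hy0.abs.eventually_le_const (u := 1 / 2) (by norm_num)] with n hn hyn
      rw [Real.norm_eq_abs, abs_mul, abs_of_pos hn]
      calc a n * _ ≤ a n * (5 * |y n| ^ 3) := by
            gcongr
            exact abs_one_add_mul_log_sub_le hyn
        _ = _ := by rw [← sq_abs]; ring
    have h3 := (h1.neg).sub (hay.div_const 2)
    rw [neg_zero, zero_sub] at h3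
    refine h3.congr fun n => ?_
    ring
  have hroot : Tendsto (fun n => √((l n : ℝ) / a n)⁻¹) f (𝓝 1) := by
    have := (hla.inv₀ one_ne_zero).sqrt
    rwa [inv_one, Real.sqrt_one] at this
  have := (hst.mul hroot).mul hexp
  rw [one_mul, one_mul] at this
  refine this.congr' ?_
  filter_upwards [hapos, hlreal.eventually_gt_atTop 0] with n hn hln
  have h1 : 1 + y n = l n / a n := by
    rw [hy]
    field_simp
    ring
  have h2 : Real.exp (a n * y n - a n * ((1 + y n) * Real.log (1 + y n))) =
      Real.exp (l n) * Real.exp (-a n) * (a n / l n) ^ l n := by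
    have h3 : a n / l n = Real.exp (-Real.log (l n / a n)) := by
      rw [← Real.log_inv, inv_div, Real.exp_log (by positivity)]
    rw [h3, ← Real.exp_nat_mul, ← Real.exp_add, ← Real.exp_add, h1]
    congr 1
    rw [hy]
    field_simp
    ring
  have h4 : √(2 * Real.pi * a n) = √(2 * l n * Real.pi) * √((l n : ℝ) / a n)⁻¹ := by
    rw [← Real.sqrt_mul (by positivity)]
    congr 1
    field_simp
  rw [h2, h4, poissonWeight, div_pow, div_pow, ← Real.exp_nat_mul, mul_one]
  field_simp

/-! ### Normalization of the number of tableaux: limit and uniform bound -/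

/-- The ratio of `n!` and its Stirling approximation. -/
noncomputable def stirlingRatio (n : ℕ) : ℝ :=
  n.factorial / (√(2 * n * Real.pi) * (n / Real.exp 1) ^ n)

theorem stirlingRatio_nonneg (n : ℕ) : 0 ≤ stirlingRatio n := by
  unfold stirlingRatio
  positivity

theorem tendsto_stirlingRatio : Tendsto stirlingRatio atTop (𝓝 1) := by
  have h := Stirling.factorial_isEquivalent_stirling
  rw [Asymptotics.isEquivalent_iff_tendsto_one] at h
  · exact h
  · filter_upwards [eventually_gt_atTop 0] with n hn
    positivity

theorem sum_card_Ioi_fin (d : ℕ) : ∑ i : Fin d, (Finset.Ioi i).card = ∑ i : Fin d, (i : ℕ) := by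
  rw [← Equiv.sum_comp Fin.revPerm (fun i : Fin d => (i : ℕ))]
  refine Finset.sum_congr rfl fun i _ => ?_
  rw [Fin.card_Ioi, Fin.revPerm_apply, Fin.val_rev]
  omega

theorem cast_sum_fin (d : ℕ) : ((∑ i : Fin d, (i : ℕ) : ℕ) : ℝ) = d * (d - 1) / 2 := by
  rw [Fin.sum_univ_eq_sum_range (fun i => i), Nat.cast_sum]
  induction d with
  | zero => simp
  | succ d ih =>
    rw [Finset.sum_range_succ, ih]
    push_cast
    ring

theorem diffProd_sub_div {d : ℕ} (v : Fin d → ℝ) (a r : ℝ) :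
    diffProd (fun i => (v i - a) / r) = diffProd v / r ^ ∑ i : Fin d, (i : ℕ) := by
  rw [← sum_card_Ioi_fin, ← Finset.prod_pow_eq_pow_sum, diffProd, diffProd,
    ← Finset.prod_div_distrib]
  refine Finset.prod_congr rfl fun i _ => ?_
  rw [← Finset.prod_const, ← Finset.prod_div_distrib]
  exact Finset.prod_congr rfl fun j _ => by ring

/-- The exponential growth factor of the number of standard tableaux with `d` rows and `n` cells,
whose shape has row lengths `n / d + O(√n)`. -/
noncomputable def growthFactor (d n : ℕ) : ℝ :=
  (2 * Real.pi) ^ (-(((d : ℝ) - 1) / 2)) * (d : ℝ) ^ ((n : ℝ) + (d : ℝ) ^ 2 / 2) *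
    (n : ℝ) ^ (-(((d : ℝ) - 1) * ((d : ℝ) + 2) / 4))

/-- The number of standard tableaux with shifted row lengths `l`, divided by `growthFactor d n`. -/
noncomputable def normalizedCount (d n : ℕ) (l : Fin d → ℕ) : ℝ :=
  stirlingRatio n * diffProd (fun i => ((l i : ℝ) - n / d) / √n) *
    ∏ i, (√(2 * Real.pi * (n / d)) * poissonWeight (n / d) (l i))

theorem growthFactor_pos {d n : ℕ} (hd : 0 < d) (hn : 0 < n) : 0 < growthFactor d n := by
  unfold growthFactor
  positivity

/-- This identity fixes the form of `growthFactor`: it is Stirling's expression for `n!`, times the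
power of `√n` from rescaling the differences, over the constants of the Poisson weights. -/
theorem growthFactor_normalization {d n : ℕ} (hd : 0 < d) (hn : 0 < n) :
    growthFactor d n * (√(2 * Real.pi * (n / d)) ^ d * Real.exp (-(n / d : ℝ)) ^ d *
        (n / d : ℝ) ^ (n + ∑ i : Fin d, (i : ℕ))) =
      √(2 * n * Real.pi) * (n / Real.exp 1) ^ n * √n ^ ∑ i : Fin d, (i : ℕ) := by
  have hc := cast_sum_fin d
  set c := ∑ i : Fin d, (i : ℕ)
  have hd' : (0 : ℝ) < d := by positivity
  have hn' : (0 : ℝ) < n := by positivity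
  have hpi : (0 : ℝ) < 2 * Real.pi := by positivity
  have ed : (n / d : ℝ) = Real.exp (Real.log n - Real.log d) := by
    rw [Real.exp_sub, Real.exp_log hn', Real.exp_log hd']
  have hsqrt : ∀ x : ℝ, √(Real.exp x) = Real.exp (x / 2) := fun x => by
    rw [Real.exp_half]
  have e1 : √(2 * Real.pi * (n / d)) = Real.exp ((Real.log (2 * Real.pi) + (Real.log n -
      Real.log d)) / 2) := by
    rw [← hsqrt, Real.exp_add, Real.exp_log hpi, ← ed]
  have e2 : √(2 * n * Real.pi) = Real.exp ((Real.log (2 * Real.pi) + Real.log n) / 2) := by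
    rw [← hsqrt, Real.exp_add, Real.exp_log hpi, Real.exp_log hn']
    congr 1
    ring
  have e3 : √(n : ℝ) = Real.exp (Real.log n / 2) := by
    rw [← hsqrt, Real.exp_log hn']
  have e4 : (n / Real.exp 1 : ℝ) = Real.exp (Real.log n - 1) := by
    rw [Real.exp_sub, Real.exp_log hn']
  have e5 : (n / d : ℝ) ^ (n + c) = Real.exp (((n + c : ℕ) : ℝ) * (Real.log n - Real.log d)) := by
    rw [Real.exp_nat_mul, ← ed]
  rw [growthFactor, e5, e1, e2, e3, e4, Real.rpow_def_of_pos hpi, Real.rpow_def_of_pos hd',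
    Real.rpow_def_of_pos hn']
  simp only [← Real.exp_nat_mul, ← Real.exp_add]
  congr 1
  push_cast
  rw [hc]
  field_simp
  ring

theorem numStandardTableaux_eq {d n : ℕ} (hd : 0 < d) (hn : 0 < n) {μ : YoungDiagram}
    (hμ : μ.card = n) (hμd : μ.colLen 0 ≤ d) :
    (numStandardTableaux μ : ℝ) = growthFactor d n * normalizedCount d n (shiftedRowLen d μ) := by
  have hframe := numStandardTableaux_mul_prod_factorial μ hμd
  have hnorm := growthFactor_normalization hd hn
  have hsum : ∑ i, shiftedRowLen d μ i = n + ∑ i : Fin d, (i : ℕ) := by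
    have := sum_shiftedRowLen hμd
    rw [hμ] at this
    exact_mod_cast this
  rw [normalizedCount, diffProd_sub_div]
  have hprod : ∏ i, (√(2 * Real.pi * (n / d)) * poissonWeight (n / d) (shiftedRowLen d μ i)) =
      √(2 * Real.pi * (n / d)) ^ d * Real.exp (-(n / d : ℝ)) ^ d *
        (n / d : ℝ) ^ (n + ∑ i : Fin d, (i : ℕ)) /
        ∏ i, ((shiftedRowLen d μ i).factorial : ℝ) := by
    simp only [poissonWeight]
    rw [Finset.prod_mul_distrib, Finset.prod_div_distrib, Finset.prod_mul_distrib,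
      Finset.prod_pow_eq_pow_sum, hsum]
    simp only [Finset.prod_const, Finset.card_univ, Fintype.card_fin]
    ring
  rw [hμ] at hframe
  have hF : (∏ i, ((shiftedRowLen d μ i).factorial : ℝ)) ≠ 0 :=
    Finset.prod_ne_zero_iff.2 fun i _ => by positivity
  have hX : √(2 * n * Real.pi) * (n / Real.exp 1) ^ n * √n ^ ∑ i : Fin d, (i : ℕ) ≠ 0 := by
    positivity
  rw [hprod, stirlingRatio]
  set F := ∏ i, ((shiftedRowLen d μ i).factorial : ℝ)
  set D := diffProd fun i => (shiftedRowLen d μ i : ℝ)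
  rw [← mul_right_inj' hF, mul_comm, hframe]
  have hn' : (√n ^ ∑ i : Fin d, (i : ℕ)) ≠ 0 := by positivity
  have hs : √(2 * n * Real.pi) * (n / Real.exp 1) ^ n ≠ 0 := by positivity
  set Y := √(2 * n * Real.pi) * (n / Real.exp 1) ^ n
  set Z := √n ^ ∑ i : Fin d, (i : ℕ)
  set P := √(2 * Real.pi * (n / d)) ^ d * Real.exp (-(n / d : ℝ)) ^ d *
        (n / d : ℝ) ^ (n + ∑ i : Fin d, (i : ℕ))
  calc (n.factorial : ℝ) * D = n.factorial * D * (growthFactor d n * P) / (Y * Z) := by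
        rw [hnorm]
        field_simp
    _ = _ := by
        field_simp

theorem tendsto_normalizedCount {d : ℕ} (hd : 0 < d) {L : ℕ → Fin d → ℕ} {X : Fin d → ℝ}
    (hL : ∀ i, Tendsto (fun n : ℕ => ((L n i : ℝ) - n / d) / √n) atTop (𝓝 (X i))) :
    Tendsto (fun n => normalizedCount d n (L n)) atTop
      (𝓝 (Real.exp (-(d / 2 : ℝ) * ∑ i, X i ^ 2) * diffProd X)) := by
  have hd' : (0 : ℝ) < d := by positivity
  have ha : Tendsto (fun n : ℕ => (n / d : ℝ)) atTop atTop :=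
    tendsto_natCast_atTop_atTop.atTop_div_const hd'
  have hdiff : Tendsto (fun n : ℕ => diffProd (fun i => ((L n i : ℝ) - n / d) / √n)) atTop
      (𝓝 (diffProd X)) :=
    tendsto_finsetProd _ fun i _ => tendsto_finsetProd _ fun j _ => (hL i).sub (hL j)
  have hpois : ∀ i, Tendsto (fun n : ℕ => √(2 * Real.pi * (n / d)) *
      poissonWeight (n / d) (L n i)) atTop (𝓝 (Real.exp (-(d / 2 : ℝ) * X i ^ 2))) := by
    intro i
    -- The Poisson scale is `√(n / d)` rather than `√n`, hence the factor `√d`.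
    have h := tendsto_sqrt_mul_poissonWeight (t := √d * X i) (l := fun n => L n i) ha ?_
    · rw [mul_pow, Real.sq_sqrt hd'.le] at h
      rwa [show -(d / 2 : ℝ) * X i ^ 2 = -(d * X i ^ 2 / 2) by ring]
    · refine ((hL i).const_mul (√d)).congr fun n => ?_
      rw [Real.sqrt_div (Nat.cast_nonneg n)]
      field_simp
  have h := (tendsto_stirlingRatio.mul hdiff).mul
    (tendsto_finsetProd Finset.univ fun i _ => hpois i)
  rw [← Real.exp_sum, ← Finset.mul_sum, one_mul, mul_comm (diffProd X)] at h
  exact h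

/-- A polynomial bound `(2 s)^c = 4^c (s / 2)^c`, made exponential so that it uses only half of the
decay `exp (-s)` of the Poisson weights. -/
theorem abs_diffProd_le {d : ℕ} (v : Fin d → ℝ) :
    |diffProd v| ≤ 4 ^ (∑ i : Fin d, (i : ℕ)) * (∑ i : Fin d, (i : ℕ)).factorial *
      Real.exp ((∑ i, |v i|) / 2) := by
  set c := ∑ i : Fin d, (i : ℕ) with hc
  set s := ∑ i, |v i| with hs
  have hs0 : 0 ≤ s := Finset.sum_nonneg fun i _ => abs_nonneg _
  have h1 : |diffProd v| ≤ (2 * s) ^ c := by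
    rw [hc, ← sum_card_Ioi_fin, ← Finset.prod_pow_eq_pow_sum, diffProd, Finset.abs_prod]
    refine Finset.prod_le_prod (fun i _ => abs_nonneg _) fun i _ => ?_
    rw [Finset.abs_prod, ← Finset.prod_const]
    refine Finset.prod_le_prod (fun i _ => abs_nonneg _) fun j _ => ?_
    have hi := Finset.single_le_sum (f := fun i => |v i|) (fun i _ => abs_nonneg _)
      (Finset.mem_univ i)
    have hj := Finset.single_le_sum (f := fun i => |v i|) (fun i _ => abs_nonneg _)
      (Finset.mem_univ j)
    have := abs_sub (v i) (v j)
    linarith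
  have h2 := Real.pow_div_factorial_le_exp (s / 2) (by positivity) c
  rw [div_le_iff₀ (by positivity)] at h2
  calc _ ≤ (2 * s) ^ c := h1
    _ = 4 ^ c * (s / 2) ^ c := by rw [← mul_pow]; congr 1; ring
    _ ≤ 4 ^ c * (Real.exp (s / 2) * c.factorial) := by gcongr
    _ = _ := by ring

theorem exists_abs_normalizedCount_le {d : ℕ} (hd : 0 < d) :
    ∃ K : ℝ, 0 < K ∧ ∀ n : ℕ, d ≤ n → ∀ l : Fin d → ℕ,
      |normalizedCount d n l| ≤ K * Real.exp (-((∑ i, |((l i : ℝ) - n / d) / √n|) / 2)) := by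
  obtain ⟨B, hB⟩ := tendsto_stirlingRatio.bddAbove_range
  have hB : ∀ n, stirlingRatio n ≤ B := fun n => hB ⟨n, rfl⟩
  have hB0 : 0 ≤ B := (stirlingRatio_nonneg 0).trans (hB 0)
  set c := ∑ i : Fin d, (i : ℕ)
  set Q : ℝ := √(2 * Real.pi) * Real.exp 2
  -- The summand `1` only serves to make the constant positive.
  refine ⟨B * (4 ^ c * c.factorial) * Q ^ d + 1, by positivity, fun n hn l => ?_⟩
  have hd' : (0 : ℝ) < d := by positivity
  have hd1 : (1 : ℝ) ≤ d := by exact_mod_cast hd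
  have hn' : (0 : ℝ) < n := by
    have : 0 < n := by omega
    positivity
  have ha : (1 : ℝ) ≤ n / d := by
    rw [one_le_div hd']
    exact_mod_cast hn
  have hpois : ∀ i, √(2 * Real.pi * (n / d)) * poissonWeight (n / d) (l i) ≤
      Q * Real.exp (-|((l i : ℝ) - n / d) / √n|) := fun i => by
    have h1 := sqrt_mul_poissonWeight_le ha (l i)
    have h2 : |((l i : ℝ) - n / d) / √n| ≤ |(l i : ℝ) - n / d| / √(n / d) := by
      rw [abs_div, abs_of_nonneg (Real.sqrt_nonneg _)]
      gcongr
      exact div_le_self hn'.le hd1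
    rw [Real.sqrt_mul (by positivity), mul_assoc]
    calc _ ≤ √(2 * Real.pi) * (Real.exp 2 * Real.exp (-(|(l i : ℝ) - n / d| / √(n / d)))) := by
          gcongr
      _ ≤ √(2 * Real.pi) * (Real.exp 2 * Real.exp (-|((l i : ℝ) - n / d) / √n|)) := by gcongr
      _ = _ := by ring
  have hpos : ∀ i, 0 ≤ √(2 * Real.pi * (n / d)) * poissonWeight (n / d) (l i) := fun i =>
    mul_nonneg (Real.sqrt_nonneg _) (poissonWeight_nonneg (by positivity) _)
  have hprod : ∏ i, (√(2 * Real.pi * (n / d)) * poissonWeight (n / d) (l i)) ≤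
      Q ^ d * Real.exp (-∑ i, |((l i : ℝ) - n / d) / √n|) := by
    refine (Finset.prod_le_prod (fun i _ => hpos i) fun i _ => hpois i).trans_eq ?_
    rw [Finset.prod_mul_distrib, ← Real.exp_sum, Finset.sum_neg_distrib]
    simp
  have hdiff := abs_diffProd_le fun i => ((l i : ℝ) - n / d) / √n
  set s := ∑ i, |((l i : ℝ) - n / d) / √n|
  rw [normalizedCount, abs_mul, abs_mul, abs_of_nonneg (stirlingRatio_nonneg n),
    abs_of_nonneg (Finset.prod_nonneg fun i _ => hpos i)]
  have hQ : 0 ≤ Q := by positivity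
  calc _ ≤ B * (4 ^ c * c.factorial * Real.exp (s / 2)) * (Q ^ d * Real.exp (-s)) := by
        have := Finset.prod_nonneg fun i (_ : i ∈ Finset.univ) => hpos i
        gcongr
        exact hB n
    _ = B * (4 ^ c * c.factorial) * Q ^ d * (Real.exp (s / 2) * Real.exp (-s)) := by ring
    _ = B * (4 ^ c * c.factorial) * Q ^ d * Real.exp (-(s / 2)) := by
        rw [← Real.exp_add]
        ring_nf
    _ ≤ _ := by
        gcongr
        linarith

/-! ### Coordinates on the traceless hyperplane -/

section TracelessPoint

variable {m : ℕ}

theorem tracelessPoint_castSucc (x : Fin m → ℝ) (i : Fin m) :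
    tracelessPoint (m + 1) x i.castSucc = x i :=
  dif_pos i.2

theorem tracelessPoint_last (x : Fin m → ℝ) :
    tracelessPoint (m + 1) x (Fin.last m) = -∑ k, x k :=
  dif_neg (lt_irrefl m)

theorem sum_tracelessPoint (x : Fin m → ℝ) : ∑ i, tracelessPoint (m + 1) x i = 0 := by
  rw [Fin.sum_univ_castSucc, tracelessPoint_last]
  simp only [tracelessPoint_castSucc]
  exact add_neg_cancel _

theorem continuous_tracelessPoint : Continuous (tracelessPoint (m + 1) : (Fin m → ℝ) → _) := by
  refine continuous_pi fun i => ?_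
  refine Fin.lastCases ?_ (fun i => ?_) i
  · simp only [tracelessPoint_last]
    fun_prop
  · simp only [tracelessPoint_castSucc]
    fun_prop

theorem tracelessPoint_mem_tracelessChamber_iff {x : Fin m → ℝ} :
    tracelessPoint (m + 1) x ∈ tracelessChamber (m + 1) ↔ Antitone (tracelessPoint (m + 1) x) :=
  ⟨fun h => h.1, fun h => ⟨h, sum_tracelessPoint x⟩⟩

theorem chamberDensity_eq {d : ℕ} (β : ℝ) {X : Fin d → ℝ} (hX : Antitone X) :
    chamberDensity d β X = (Real.exp (-(d / 2 : ℝ) * ∑ i, X i ^ 2) * diffProd X) ^ β := by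
  have h0 : ∀ i, ∀ j ∈ Finset.Ioi i, 0 ≤ X i - X j := fun i j hj =>
    sub_nonneg.2 (hX (Finset.mem_Ioi.1 hj).le)
  rw [diffProd, Real.mul_rpow (Real.exp_pos _).le
      (Finset.prod_nonneg fun i _ => Finset.prod_nonneg (h0 i)), ← Real.exp_mul, chamberDensity,
    ← Real.finsetProd_rpow _ _ fun i _ => Finset.prod_nonneg (h0 i)]
  congr 1
  · congr 1
    ring
  · exact Finset.prod_congr rfl fun i _ => Real.finsetProd_rpow _ _ (h0 i) β

end TracelessPoint

/-! ### Partitions approximating a point of the chamber -/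

section ApproxRowLen

variable {m : ℕ}

/-- The row lengths of the partition of `n` into at most `m + 1` parts whose rescaling is closest
from below to `x`. -/
noncomputable def approxRowLen (m n : ℕ) (x : Fin m → ℝ) : Fin (m + 1) → ℕ :=
  Fin.snoc (α := fun _ => ℕ) (fun i => ⌊(n / (m + 1 : ℕ) : ℝ) + √n * x i⌋₊)
    (n - ∑ i, ⌊(n / (m + 1 : ℕ) : ℝ) + √n * x i⌋₊)

theorem approxRowLen_castSucc (n : ℕ) (x : Fin m → ℝ) (i : Fin m) :
    approxRowLen m n x i.castSucc = ⌊(n / (m + 1 : ℕ) : ℝ) + √n * x i⌋₊ :=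
  Fin.snoc_castSucc ..

theorem approxRowLen_last (n : ℕ) (x : Fin m → ℝ) :
    approxRowLen m n x (Fin.last m) = n - ∑ i, ⌊(n / (m + 1 : ℕ) : ℝ) + √n * x i⌋₊ :=
  Fin.snoc_last ..

theorem tendsto_sqrt_natCast_atTop : Tendsto (fun n : ℕ => √(n : ℝ)) atTop atTop :=
  Real.tendsto_sqrt_atTop.comp tendsto_natCast_atTop_atTop

theorem tendsto_div_sqrt_add_const {d : ℝ} (hd : 0 < d) (y : ℝ) :
    Tendsto (fun n : ℕ => (n / d : ℝ) / √n + y) atTop atTop := by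
  refine tendsto_atTop_add_const_right _ _ ?_
  refine (tendsto_sqrt_natCast_atTop.atTop_div_const hd).congr fun n => ?_
  rw [div_right_comm, Real.div_sqrt]

theorem eventually_nonneg_div_add_sqrt_mul (y : ℝ) :
    ∀ᶠ n : ℕ in atTop, 0 ≤ (n / (m + 1 : ℕ) : ℝ) + √n * y := by
  filter_upwards [(tendsto_div_sqrt_add_const (d := (m + 1 : ℕ)) (by positivity)
    y).eventually_ge_atTop 0, eventually_gt_atTop 0] with n hn hn0
  have h : 0 < √(n : ℝ) := Real.sqrt_pos.2 (by positivity)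
  have := mul_nonneg h.le hn
  rwa [mul_add, mul_div_cancel₀ _ h.ne'] at this

theorem tendsto_floor_div_add_sqrt_mul (y : ℝ) :
    Tendsto (fun n : ℕ => ((⌊(n / (m + 1 : ℕ) : ℝ) + √n * y⌋₊ : ℝ) - n / (m + 1 : ℕ)) / √n) atTop
      (𝓝 y) := by
  rw [tendsto_iff_norm_sub_tendsto_zero]
  refine squeeze_zero' (Eventually.of_forall fun n => norm_nonneg _) ?_
    (tendsto_sqrt_natCast_atTop.inv_tendsto_atTop)
  filter_upwards [eventually_nonneg_div_add_sqrt_mul (m := m) y, eventually_gt_atTop 0] with n hn hn0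
  have h : 0 < √(n : ℝ) := Real.sqrt_pos.2 (by positivity)
  have h1 := Nat.floor_le hn
  have h2 := Nat.lt_floor_add_one ((n / (m + 1 : ℕ) : ℝ) + √n * y)
  set k := ⌊(n / (m + 1 : ℕ) : ℝ) + √n * y⌋₊
  have e : ((k : ℝ) - n / (m + 1 : ℕ)) / √n - y =
      (k - ((n / (m + 1 : ℕ) : ℝ) + √n * y)) / √n := by
    field_simp
    ring
  rw [e, Real.norm_eq_abs, abs_div, abs_of_pos h, Pi.inv_apply, div_eq_mul_inv]
  refine mul_le_of_le_one_left (by positivity) ?_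
  rw [abs_le]
  constructor <;> linarith

theorem tendsto_remainder (x : Fin m → ℝ) :
    Tendsto (fun n : ℕ => ((n - ∑ i, (⌊(n / (m + 1 : ℕ) : ℝ) + √n * x i⌋₊ : ℝ)) -
      n / (m + 1 : ℕ)) / √n) atTop (𝓝 (-∑ i, x i)) := by
  have h := (tendsto_finsetSum (Finset.univ : Finset (Fin m)) fun i _ =>
    tendsto_floor_div_add_sqrt_mul (m := m) (x i)).neg
  refine h.congr fun n => ?_
  rw [← Finset.sum_div, Finset.sum_sub_distrib, ← neg_div]
  congr 1
  simp only [Finset.sum_const, Finset.card_univ, Fintype.card_fin, nsmul_eq_mul]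
  push_cast
  field_simp
  ring

/-- Ensures that the natural subtraction in the last row does not truncate: the remainder over `√n`
is `√n / (m + 1) - ∑ x_i + o(1)`. -/
theorem eventually_sum_floor_le (x : Fin m → ℝ) :
    ∀ᶠ n : ℕ in atTop, ∑ i, ⌊(n / (m + 1 : ℕ) : ℝ) + √n * x i⌋₊ ≤ n := by
  have h1 := tendsto_div_sqrt_add_const (d := (m + 1 : ℕ)) (by positivity) (-(∑ i, x i) - 1)
  filter_upwards [h1.eventually_ge_atTop 0, eventually_gt_atTop 0,
    (tendsto_remainder x).eventually_const_le (u := -(∑ i, x i) - 1) (by linarith)]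
    with n h1 hn0 h2
  have h : 0 < √(n : ℝ) := Real.sqrt_pos.2 (by positivity)
  have h3 : 0 ≤ (n - ∑ i, (⌊(n / (m + 1 : ℕ) : ℝ) + √n * x i⌋₊ : ℝ)) / √n := by
    rw [sub_div] at h2
    linarith
  have h4 := (le_div_iff₀ h).1 h3
  have h5 : ((∑ i, ⌊(n / (m + 1 : ℕ) : ℝ) + √n * x i⌋₊ : ℕ) : ℝ) ≤ n := by
    push_cast at h4 ⊢
    linarith
  exact_mod_cast h5

theorem tendsto_approxRowLen (x : Fin m → ℝ) (i : Fin (m + 1)) :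
    Tendsto (fun n : ℕ => ((approxRowLen m n x i : ℝ) - n / (m + 1 : ℕ)) / √n) atTop
      (𝓝 (tracelessPoint (m + 1) x i)) := by
  refine Fin.lastCases ?_ (fun i => ?_) i
  · rw [tracelessPoint_last]
    refine (tendsto_remainder x).congr' ?_
    filter_upwards [eventually_sum_floor_le x] with n hn
    rw [approxRowLen_last, Nat.cast_sub hn]
    push_cast
    rfl
  · simp only [tracelessPoint_castSucc, approxRowLen_castSucc]
    exact tendsto_floor_div_add_sqrt_mul (x i)

theorem eventually_approxRowLen_lt {x : Fin m → ℝ} {i j : Fin (m + 1)}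
    (h : tracelessPoint (m + 1) x i < tracelessPoint (m + 1) x j) :
    ∀ᶠ n : ℕ in atTop, approxRowLen m n x i < approxRowLen m n x j := by
  filter_upwards [(tendsto_approxRowLen x i).eventually_lt (tendsto_approxRowLen x j) h,
    eventually_gt_atTop 0] with n hn hn0
  have h : 0 < √(n : ℝ) := Real.sqrt_pos.2 (by positivity)
  rw [div_lt_div_iff_of_pos_right h] at hn
  have : (approxRowLen m n x i : ℝ) < approxRowLen m n x j := by linarith
  exact_mod_cast this

theorem tendsto_approxRowLen_add (x : Fin m → ℝ) (i : Fin (m + 1)) (k : ℕ) :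
    Tendsto (fun n : ℕ => (((approxRowLen m n x i + k : ℕ) : ℝ) - n / (m + 1 : ℕ)) / √n) atTop
      (𝓝 (tracelessPoint (m + 1) x i)) := by
  have h := (tendsto_approxRowLen x i).add
    (tendsto_sqrt_natCast_atTop.const_div_atTop (k : ℝ))
  rw [add_zero] at h
  refine h.congr fun n => ?_
  push_cast
  ring

theorem YoungDiagram.exists_rowLen_eq {d : ℕ} {r : Fin d → ℕ} (hr : Antitone r) :
    ∃ μ : YoungDiagram, μ.colLen 0 ≤ d ∧ ∀ i : Fin d, μ.rowLen i = r i := by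
  refine ⟨YoungDiagram.ofRowLens (List.ofFn r) hr.sortedGE_ofFn, ?_, fun i => ?_⟩
  · rw [YoungDiagram.colLen_zero_le_iff]
    by_contra h
    have := YoungDiagram.mem_iff_lt_rowLen.2 (Nat.pos_of_ne_zero h)
    rw [YoungDiagram.mem_ofRowLens] at this
    obtain ⟨h1, -⟩ := this
    simp at h1
  · have := YoungDiagram.rowLen_ofRowLens (hw := hr.sortedGE_ofFn)
      (⟨i, by simp⟩ : Fin (List.ofFn r).length)
    simpa using this

/-- The points `x` for which the first `m` row lengths of `μ` are `⌊n / (m + 1) + √n x_i⌋`. -/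
def rescaledCell (m n : ℕ) (μ : YoungDiagram) : Set (Fin m → ℝ) :=
  {x | ∀ i, ⌊(n / (m + 1 : ℕ) : ℝ) + √n * x i⌋ = (μ.rowLen i : ℤ)}

theorem mem_partitionsOfLengthLE {n d : ℕ} {μ : YoungDiagram} :
    μ ∈ partitionsOfLengthLE n d ↔ μ.card = n ∧ μ.colLen 0 ≤ d :=
  Set.Finite.mem_toFinset _

/-- The cell fixes the first `m` rows and the size `n` forces the last one; hence different
partitions have disjoint cells. -/
theorem rowLen_eq_approxRowLen {n : ℕ} {μ : YoungDiagram} {x : Fin m → ℝ}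
    (hμ : μ ∈ partitionsOfLengthLE n (m + 1)) (hx : x ∈ rescaledCell m n μ) (i : Fin (m + 1)) :
    μ.rowLen i = approxRowLen m n x i := by
  obtain ⟨hcard, hcol⟩ := mem_partitionsOfLengthLE.1 hμ
  have h : ∀ i : Fin m, ⌊(n / (m + 1 : ℕ) : ℝ) + √n * x i⌋₊ = μ.rowLen i := fun i => by
    rw [← Int.floor_toNat, hx i, Int.toNat_natCast]
  refine Fin.lastCases ?_ (fun i => ?_) i
  · have hsum := YoungDiagram.card_eq_sum_rowLen hcol
    rw [Fin.sum_univ_castSucc, hcard] at hsum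
    simp only [approxRowLen_last, h]
    simp only [Fin.val_castSucc] at hsum
    omega
  · rw [approxRowLen_castSucc, h]
    rfl

theorem YoungDiagram.ext_rowLen {d : ℕ} {μ ν : YoungDiagram} (hμ : μ.colLen 0 ≤ d)
    (hν : ν.colLen 0 ≤ d) (h : ∀ i : Fin d, μ.rowLen i = ν.rowLen i) : μ = ν := by
  ext ⟨i, j⟩
  rw [YoungDiagram.mem_cells, YoungDiagram.mem_cells, YoungDiagram.mem_iff_lt_rowLen,
    YoungDiagram.mem_iff_lt_rowLen]
  by_cases hi : i < d
  · rw [h ⟨i, hi⟩]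
  · have h1 := μ.rowLen_anti d i (by omega)
    have h2 := ν.rowLen_anti d i (by omega)
    rw [YoungDiagram.colLen_zero_le_iff] at hμ hν
    omega

/-- Strict inequalities survive rounding, whereas ties might be broken in the wrong order. -/
theorem eventually_exists_mem_rescaledCell {x : Fin m → ℝ}
    (hx : StrictAnti (tracelessPoint (m + 1) x)) :
    ∀ᶠ n : ℕ in atTop, ∃ μ ∈ partitionsOfLengthLE n (m + 1), x ∈ rescaledCell m n μ := by
  have h1 : ∀ᶠ n : ℕ in atTop, ∀ i j : Fin (m + 1), i < j →
      approxRowLen m n x j < approxRowLen m n x i := by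
    refine eventually_all.2 fun i => eventually_all.2 fun j => ?_
    by_cases hij : i < j
    · filter_upwards [eventually_approxRowLen_lt (hx hij)] with n hn _ using hn
    · exact Eventually.of_forall fun n h => absurd h hij
  have h2 : ∀ᶠ n : ℕ in atTop, ∀ i : Fin m, 0 ≤ (n / (m + 1 : ℕ) : ℝ) + √n * x i :=
    eventually_all.2 fun i => eventually_nonneg_div_add_sqrt_mul (x i)
  filter_upwards [h1, h2, eventually_sum_floor_le x] with n h1 h2 h3
  have hanti : StrictAnti (approxRowLen m n x) := fun i j hij => h1 i j hij
  obtain ⟨μ, hμ, hrow⟩ := YoungDiagram.exists_rowLen_eq hanti.antitone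
  refine ⟨μ, mem_partitionsOfLengthLE.2 ⟨?_, hμ⟩, fun i => ?_⟩
  · rw [YoungDiagram.card_eq_sum_rowLen hμ]
    simp only [hrow]
    rw [Fin.sum_univ_castSucc, approxRowLen_last]
    simp only [approxRowLen_castSucc]
    omega
  · have := hrow i.castSucc
    rw [approxRowLen_castSucc] at this
    rw [Fin.val_castSucc] at this
    rw [this, Int.natCast_floor_eq_floor (h2 i)]

end ApproxRowLen

/-! ### The step function and dominated convergence -/

section StepFunction

variable {m : ℕ}

/-- The integer floor matters: with the natural floor, cells with an empty row would be unbounded.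
-/
theorem rescaledCell_eq_pi {n : ℕ} (hn : 0 < n) (μ : YoungDiagram) :
    rescaledCell m n μ = Set.univ.pi fun i : Fin m =>
      Set.Ico (((μ.rowLen i : ℝ) - n / (m + 1 : ℕ)) / √n)
        (((μ.rowLen i : ℝ) + 1 - n / (m + 1 : ℕ)) / √n) := by
  have h : 0 < √(n : ℝ) := Real.sqrt_pos.2 (by positivity)
  ext x
  simp only [rescaledCell, Set.mem_ofPred_eq, Set.mem_univ_pi, Set.mem_Ico, Int.floor_eq_iff,
    Int.cast_natCast]
  refine forall_congr' fun i => ?_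
  rw [div_le_iff₀ h, lt_div_iff₀ h, mul_comm (x i)]
  constructor <;> rintro ⟨h1, h2⟩ <;> constructor <;> linarith

theorem measurableSet_rescaledCell {n : ℕ} (hn : 0 < n) (μ : YoungDiagram) :
    MeasurableSet (rescaledCell m n μ) := by
  rw [rescaledCell_eq_pi hn]
  exact MeasurableSet.univ_pi fun i => measurableSet_Ico

theorem volume_rescaledCell {n : ℕ} (hn : 0 < n) (μ : YoungDiagram) :
    volume (rescaledCell m n μ) = ENNReal.ofReal (1 / √n) ^ m := by
  rw [rescaledCell_eq_pi hn, Real.volume_pi_Ico]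
  have h : ∀ i : Fin m, ((μ.rowLen i : ℝ) + 1 - n / (m + 1 : ℕ)) / √n -
      ((μ.rowLen i : ℝ) - n / (m + 1 : ℕ)) / √n = 1 / √n := fun i => by ring
  simp only [h, Finset.prod_const, Finset.card_univ, Fintype.card_fin]

/-- The step function whose integral is the normalized sum over the partitions of `n`. -/
noncomputable def stepDensity (m : ℕ) (β : ℝ) (n : ℕ) (x : Fin m → ℝ) : ℝ :=
  ∑ μ ∈ partitionsOfLengthLE n (m + 1), (rescaledCell m n μ).indicator
    (fun _ => normalizedCount (m + 1) n (shiftedRowLen (m + 1) μ) ^ β) x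

theorem stepDensity_of_mem (β : ℝ) {n : ℕ} {μ : YoungDiagram} {x : Fin m → ℝ}
    (hμ : μ ∈ partitionsOfLengthLE n (m + 1)) (hx : x ∈ rescaledCell m n μ) :
    stepDensity m β n x = normalizedCount (m + 1) n (shiftedRowLen (m + 1) μ) ^ β := by
  rw [stepDensity, Finset.sum_eq_single_of_mem μ hμ, Set.indicator_of_mem hx]
  intro ν hν hne
  refine Set.indicator_of_notMem (fun hx' => hne ?_) _
  refine YoungDiagram.ext_rowLen (mem_partitionsOfLengthLE.1 hν).2
    (mem_partitionsOfLengthLE.1 hμ).2 fun i => ?_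
  rw [rowLen_eq_approxRowLen hν hx', rowLen_eq_approxRowLen hμ hx]

theorem stepDensity_of_forall_notMem (β : ℝ) {n : ℕ} {x : Fin m → ℝ}
    (h : ∀ μ ∈ partitionsOfLengthLE n (m + 1), x ∉ rescaledCell m n μ) :
    stepDensity m β n x = 0 :=
  Finset.sum_eq_zero fun μ hμ => Set.indicator_of_notMem (h μ hμ) _

theorem measurable_stepDensity (β : ℝ) {n : ℕ} (hn : 0 < n) : Measurable (stepDensity m β n) :=
  Finset.measurable_sum _ fun μ _ =>
    measurable_const.indicator (measurableSet_rescaledCell hn μ)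

theorem normalizedCount_shiftedRowLen_nonneg {d n : ℕ} (hd : 0 < d) (hn : 0 < n)
    {μ : YoungDiagram} (hμ : μ ∈ partitionsOfLengthLE n d) :
    0 ≤ normalizedCount d n (shiftedRowLen d μ) := by
  obtain ⟨h1, h2⟩ := mem_partitionsOfLengthLE.1 hμ
  have h := numStandardTableaux_eq hd hn h1 h2
  refine nonneg_of_mul_nonneg_right ?_ (growthFactor_pos hd hn)
  rw [← h]
  positivity

theorem sum_rpow_eq_integral (β : ℝ) {n : ℕ} (hn : 0 < n) :
    ∑ μ ∈ partitionsOfLengthLE n (m + 1), (numStandardTableaux μ : ℝ) ^ β =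
      growthFactor (m + 1) n ^ β * (n : ℝ) ^ ((m : ℝ) / 2) * ∫ x, stepDensity m β n x := by
  have hn' : (0 : ℝ) < n := by positivity
  have hintegral : ∫ x, stepDensity m β n x = ∑ μ ∈ partitionsOfLengthLE n (m + 1),
      (1 / √n) ^ m * normalizedCount (m + 1) n (shiftedRowLen (m + 1) μ) ^ β := by
    simp only [stepDensity]
    rw [integral_finsetSum]
    · refine Finset.sum_congr rfl fun μ _ => ?_
      rw [integral_indicator_const _ (measurableSet_rescaledCell hn μ), Measure.real,
        volume_rescaledCell hn, ENNReal.toReal_pow, ENNReal.toReal_ofReal (by positivity),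
        smul_eq_mul]
    · intro μ _
      refine (integrable_indicator_iff (measurableSet_rescaledCell hn μ)).2
        (integrableOn_const ?_)
      rw [volume_rescaledCell hn]
      exact ENNReal.pow_ne_top ENNReal.ofReal_ne_top
  have hpow : (n : ℝ) ^ ((m : ℝ) / 2) * (1 / √n) ^ m = 1 := by
    rw [show (m : ℝ) / 2 = 1 / 2 * m by ring, Real.rpow_mul hn'.le, ← Real.sqrt_eq_rpow,
      Real.rpow_natCast, ← mul_pow, mul_one_div_cancel (by positivity), one_pow]
  rw [hintegral, ← Finset.mul_sum, ← mul_assoc, mul_assoc (_ ^ β), hpow, mul_one, Finset.mul_sum]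
  refine Finset.sum_congr rfl fun μ hμ => ?_
  obtain ⟨h1, h2⟩ := mem_partitionsOfLengthLE.1 hμ
  rw [numStandardTableaux_eq (Nat.succ_pos m) hn h1 h2, Real.mul_rpow
    (growthFactor_pos (Nat.succ_pos m) hn).le
    (normalizedCount_shiftedRowLen_nonneg (Nat.succ_pos m) hn hμ)]

/-- The pointwise limit of `stepDensity`. -/
noncomputable def limitDensity (m : ℕ) (β : ℝ) : (Fin m → ℝ) → ℝ :=
  {x | tracelessPoint (m + 1) x ∈ tracelessChamber (m + 1)}.indicator
    fun x => chamberDensity (m + 1) β (tracelessPoint (m + 1) x)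

theorem limitDensity_of_antitone (β : ℝ) {x : Fin m → ℝ}
    (h : Antitone (tracelessPoint (m + 1) x)) :
    limitDensity m β x = chamberDensity (m + 1) β (tracelessPoint (m + 1) x) :=
  Set.indicator_of_mem (s := {x | tracelessPoint (m + 1) x ∈ tracelessChamber (m + 1)})
    (tracelessPoint_mem_tracelessChamber_iff.2 h) _

theorem limitDensity_of_not_antitone (β : ℝ) {x : Fin m → ℝ}
    (h : ¬Antitone (tracelessPoint (m + 1) x)) : limitDensity m β x = 0 :=
  Set.indicator_of_notMem (s := {x | tracelessPoint (m + 1) x ∈ tracelessChamber (m + 1)})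
    (mt tracelessPoint_mem_tracelessChamber_iff.1 h) _

/-- Inside the chamber `x` eventually lies in a cell. On a wall it may or may not, but the limit is
zero either way because `β > 0`. Outside, it eventually lies in no cell, since row lengths decrease.
-/
theorem tendsto_stepDensity {β : ℝ} (hβ : 0 < β) (x : Fin m → ℝ) :
    Tendsto (fun n => stepDensity m β n x) atTop (𝓝 (limitDensity m β x)) := by
  set X := tracelessPoint (m + 1) x
  set L : ℕ → Fin (m + 1) → ℕ := fun n i => approxRowLen m n x i + (m + 1 - 1 - i)
  have hshift : ∀ n, ∀ μ ∈ partitionsOfLengthLE n (m + 1), x ∈ rescaledCell m n μ →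
      shiftedRowLen (m + 1) μ = L n := fun n μ hμ hx => by
    funext i
    rw [shiftedRowLen, rowLen_eq_approxRowLen hμ hx]
  have hlim : Tendsto (fun n => normalizedCount (m + 1) n (L n) ^ β) atTop
      (𝓝 ((Real.exp (-((m + 1 : ℕ) / 2 : ℝ) * ∑ i, X i ^ 2) * diffProd X) ^ β)) :=
    (tendsto_normalizedCount (Nat.succ_pos m) fun i => tendsto_approxRowLen_add x i _).rpow_const
      (Or.inr hβ.le)
  by_cases hanti : Antitone X
  · rw [limitDensity_of_antitone β hanti, chamberDensity_eq β hanti]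
    by_cases hstrict : StrictAnti X
    · refine hlim.congr' ?_
      filter_upwards [eventually_exists_mem_rescaledCell hstrict] with n ⟨μ, hμ, hx⟩
      rw [stepDensity_of_mem β hμ hx, hshift n μ hμ hx]
    · have : ∃ i j, i < j ∧ X i = X j := by
        by_contra! h
        exact hstrict fun i j hij => lt_of_le_of_ne (hanti hij.le) (h i j hij).symm
      obtain ⟨i, j, hij, h⟩ := this
      rw [diffProd_eq_zero hij h, mul_zero, Real.zero_rpow hβ.ne'] at hlim ⊢
      have hlim' := hlim.abs
      rw [abs_zero] at hlim'
      refine squeeze_zero_norm (fun n => ?_) hlim'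
      by_cases h : ∃ μ ∈ partitionsOfLengthLE n (m + 1), x ∈ rescaledCell m n μ
      · obtain ⟨μ, hμ, hx⟩ := h
        rw [stepDensity_of_mem β hμ hx, hshift n μ hμ hx, Real.norm_eq_abs]
      · rw [stepDensity_of_forall_notMem β (by simpa using h), norm_zero]
        exact abs_nonneg _
  · rw [limitDensity_of_not_antitone β hanti]
    have : ∃ i j, i ≤ j ∧ X i < X j := by
      simpa [Antitone] using hanti
    obtain ⟨i, j, hij, h⟩ := this
    refine tendsto_const_nhds.congr' ?_
    filter_upwards [eventually_approxRowLen_lt h] with n hn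
    refine (stepDensity_of_forall_notMem β fun μ hμ hx => ?_).symm
    have := μ.rowLen_anti i j hij
    rw [rowLen_eq_approxRowLen hμ hx, rowLen_eq_approxRowLen hμ hx] at this
    omega

theorem integrable_exp_neg_mul_abs {b : ℝ} (hb : 0 < b) :
    Integrable fun x : ℝ => Real.exp (-(b * |x|)) := by
  rw [← integrableOn_univ, ← Set.Iic_union_Ioi (a := (0 : ℝ))]
  refine IntegrableOn.union ?_ ?_
  · refine (integrableOn_exp_mul_Iic hb 0).congr_fun (fun x hx => ?_) measurableSet_Iic
    simp only
    rw [abs_of_nonpos hx, mul_neg, neg_neg]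
  · refine (integrableOn_exp_mul_Ioi (neg_neg_of_pos hb) 0).congr_fun (fun x hx => ?_)
      measurableSet_Ioi
    simp only
    rw [abs_of_pos hx, neg_mul]

theorem integrable_exp_neg_mul_sum_abs {b : ℝ} (hb : 0 < b) :
    Integrable fun x : Fin m → ℝ => Real.exp (-(b * ∑ i, |x i|)) := by
  have h := Integrable.fintype_prod (μ := fun _ : Fin m => (volume : Measure ℝ))
    (f := fun _ x => Real.exp (-(b * |x|))) fun _ => integrable_exp_neg_mul_abs hb
  refine h.congr (Eventually.of_forall fun x => ?_)
  simp only
  rw [← Real.exp_sum, Finset.sum_neg_distrib, Finset.mul_sum]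

theorem exists_norm_stepDensity_le (m : ℕ) {β : ℝ} (hβ : 0 < β) :
    ∃ K : ℝ, ∀ n : ℕ, m + 1 ≤ n → ∀ x,
      ‖stepDensity m β n x‖ ≤ K * Real.exp (-(β / 2 * ∑ i, |x i|)) := by
  obtain ⟨K, hK, hbound⟩ := exists_abs_normalizedCount_le (Nat.succ_pos m)
  -- Each of the `m` free coordinates moves by at most `m + 1`: at most `m` from the shift and `1`
  -- from the floor, before division by `√n ≥ 1`. The last coordinate is dropped.
  refine ⟨K ^ β * Real.exp (β / 2 * (m * (m + 1))), fun n hn x => ?_⟩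
  by_cases h : ∃ μ ∈ partitionsOfLengthLE n (m + 1), x ∈ rescaledCell m n μ
  · obtain ⟨μ, hμ, hx⟩ := h
    have hn0 : 0 < n := by omega
    have hs1 : 1 ≤ √(n : ℝ) := Real.one_le_sqrt.2 (by exact_mod_cast hn0)
    have hpos := normalizedCount_shiftedRowLen_nonneg (Nat.succ_pos m) hn0 hμ
    have hb := hbound n hn (shiftedRowLen (m + 1) μ)
    rw [abs_of_nonneg hpos] at hb
    have hx' : ∀ i : Fin m, |x i| - (m + 1) ≤
        |((shiftedRowLen (m + 1) μ i.castSucc : ℝ) - n / (m + 1 : ℕ)) / √n| := fun i => by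
      have h1 := Int.floor_eq_iff.1 (hx i)
      rw [Int.cast_natCast] at h1
      set z := (n / (m + 1 : ℕ) : ℝ)
      have h2 : (shiftedRowLen (m + 1) μ i.castSucc : ℝ) = μ.rowLen i + (m - i : ℕ) := by
        rw [shiftedRowLen]
        push_cast
        rfl
      have h3 : ((m - i : ℕ) : ℝ) ≤ m := by exact_mod_cast Nat.sub_le m i
      have h3' : (0 : ℝ) ≤ ((m - i : ℕ) : ℝ) := Nat.cast_nonneg _
      have h4 : |x i - ((shiftedRowLen (m + 1) μ i.castSucc : ℝ) - z) / √n| ≤ m + 1 := by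
        have e : x i - ((shiftedRowLen (m + 1) μ i.castSucc : ℝ) - z) / √n =
            (z + √n * x i - shiftedRowLen (m + 1) μ i.castSucc) / √n := by
          field_simp
          ring
        rw [e, abs_div, abs_of_pos (by positivity : 0 < √(n : ℝ))]
        refine (div_le_self (abs_nonneg _) hs1).trans ?_
        rw [h2, abs_le]
        constructor <;> linarith
      have := abs_sub_abs_le_abs_sub (x i)
        (((shiftedRowLen (m + 1) μ i.castSucc : ℝ) - z) / √n)
      linarith
    have hsum : ∑ i, |x i| - m * (m + 1) ≤
        ∑ i, |((shiftedRowLen (m + 1) μ i : ℝ) - n / (m + 1 : ℕ)) / √n| := by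
      rw [Fin.sum_univ_castSucc]
      have h1 := Finset.sum_le_sum fun i (_ : i ∈ Finset.univ) => hx' i
      rw [Finset.sum_sub_distrib] at h1
      simp only [Finset.sum_const, Finset.card_univ, Fintype.card_fin, nsmul_eq_mul] at h1
      have h2 := abs_nonneg
        (((shiftedRowLen (m + 1) μ (Fin.last m) : ℝ) - n / (m + 1 : ℕ)) / √n)
      linarith
    rw [stepDensity_of_mem β hμ hx, Real.norm_eq_abs, abs_of_nonneg (Real.rpow_nonneg hpos β)]
    calc _ ≤ (K * Real.exp (-((∑ i, |((shiftedRowLen (m + 1) μ i : ℝ) -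
              n / (m + 1 : ℕ)) / √n|) / 2))) ^ β := Real.rpow_le_rpow hpos hb hβ.le
      _ ≤ (K * Real.exp (-((∑ i, |x i| - m * (m + 1)) / 2))) ^ β := by
          gcongr
      _ = _ := by
          rw [Real.mul_rpow hK.le (Real.exp_pos _).le, ← Real.exp_mul, mul_assoc, ← Real.exp_add]
          ring_nf
  · rw [stepDensity_of_forall_notMem β (by simpa using h), norm_zero]
    positivity

theorem integrable_limitDensity_and_tendsto {β : ℝ} (hβ : 0 < β) :
    Integrable (limitDensity m β) ∧
      Tendsto (fun n => ∫ x, stepDensity m β n x) atTop (𝓝 (∫ x, limitDensity m β x)) := by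
  obtain ⟨K, hK⟩ := exists_norm_stepDensity_le m hβ
  have hintegral := (integrable_exp_neg_mul_sum_abs (m := m) (half_pos hβ)).const_mul K
  constructor
  · refine hintegral.mono' ?_ (Eventually.of_forall fun x => ?_)
    -- The index `n + 1` avoids `n = 0`, where the cells are not cubes.
    · refine aestronglyMeasurable_of_tendsto_ae (u := atTop) (f := fun n => stepDensity m β (n + 1))
        (fun n => (measurable_stepDensity β (Nat.succ_pos n)).aestronglyMeasurable)
        (Eventually.of_forall fun x => ?_)
      exact (tendsto_add_atTop_iff_nat 1).2 (tendsto_stepDensity hβ x)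
    · refine le_of_tendsto (tendsto_stepDensity hβ x).norm ?_
      filter_upwards [eventually_ge_atTop (m + 1)] with n hn using hK n hn x
  · refine tendsto_integral_filter_of_dominated_convergence _ ?_ ?_ hintegral
      (Eventually.of_forall fun x => tendsto_stepDensity hβ x)
    · filter_upwards [eventually_gt_atTop 0] with n hn
      exact (measurable_stepDensity β hn).aestronglyMeasurable
    · filter_upwards [eventually_ge_atTop (m + 1)] with n hn
      exact Eventually.of_forall (hK n hn)

/-! ### Positivity of the limit integral and the conclusion -/

theorem exists_strictAnti_tracelessPoint (m : ℕ) :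
    ∃ x : Fin m → ℝ, StrictAnti (tracelessPoint (m + 1) x) := by
  -- The progression `m, m - 2, …, -m` is decreasing with sum zero, so its last term is the one
  -- `tracelessPoint` supplies.
  refine ⟨fun i => m - 2 * i, ?_⟩
  have h : tracelessPoint (m + 1) (fun i : Fin m => (m - 2 * i : ℝ)) =
      fun i : Fin (m + 1) => (m - 2 * i : ℝ) := by
    funext i
    refine Fin.lastCases ?_ (fun i => ?_) i
    · rw [tracelessPoint_last, Finset.sum_sub_distrib, ← Finset.mul_sum]
      have := cast_sum_fin m
      push_cast at this
      rw [this]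
      simp
      ring
    · rw [tracelessPoint_castSucc]
      rfl
  rw [h]
  intro i j hij
  have : (i : ℝ) < j := by exact_mod_cast hij
  simp only
  linarith

theorem isOpen_setOf_strictAnti_tracelessPoint (m : ℕ) :
    IsOpen {x : Fin m → ℝ | StrictAnti (tracelessPoint (m + 1) x)} := by
  have : {x : Fin m → ℝ | StrictAnti (tracelessPoint (m + 1) x)} =
      ⋂ (i : Fin (m + 1)) (j : Fin (m + 1)) (_ : i < j),
        {x | tracelessPoint (m + 1) x j < tracelessPoint (m + 1) x i} := by
    ext x
    simp only [Set.mem_ofPred_eq, Set.mem_iInter]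
    exact ⟨fun h i j hij => h hij, fun h i j hij => h i j hij⟩
  rw [this]
  refine isOpen_iInter_of_finite fun i => isOpen_iInter_of_finite fun j =>
    isOpen_iInter_of_finite fun _ => isOpen_lt ?_ ?_
  · exact (continuous_apply j).comp continuous_tracelessPoint
  · exact (continuous_apply i).comp continuous_tracelessPoint

theorem limitDensity_nonneg (β : ℝ) (x : Fin m → ℝ) : 0 ≤ limitDensity m β x := by
  refine Set.indicator_nonneg (fun x hx => ?_) x
  refine mul_nonneg (Real.exp_pos _).le
    (Finset.prod_nonneg fun i _ => Finset.prod_nonneg fun j hj => Real.rpow_nonneg ?_ β)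
  exact sub_nonneg.2 (hx.1 (Finset.mem_Ioi.1 hj).le)

/-- The density is positive on the open interior of the chamber. Being nonzero is what makes
convergence an asymptotic equivalence. -/
theorem integral_limitDensity_pos {β : ℝ} (hβ : 0 < β) : 0 < ∫ x, limitDensity m β x := by
  rw [integral_pos_iff_support_of_nonneg (limitDensity_nonneg β)
    (integrable_limitDensity_and_tendsto hβ).1]
  refine ((isOpen_setOf_strictAnti_tracelessPoint m).measure_pos volume
    (exists_strictAnti_tracelessPoint m)).trans_le (measure_mono fun x hx => ?_)
  have hx : StrictAnti (tracelessPoint (m + 1) x) := hx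
  rw [Function.mem_support, limitDensity_of_antitone β hx.antitone]
  refine (mul_pos (Real.exp_pos _)
    (Finset.prod_pos fun i _ => Finset.prod_pos fun j hj => Real.rpow_pos_of_pos ?_ β)).ne'
  exact sub_pos.2 (hx (Finset.mem_Ioi.1 hj))

theorem chamberIntegral_eq_integral_limitDensity (m : ℕ) (β : ℝ) :
    chamberIntegral (m + 1) β = ∫ x, limitDensity m β x := by
  have hmeas : MeasurableSet
      {x : Fin m → ℝ | tracelessPoint (m + 1) x ∈ tracelessChamber (m + 1)} := by
    have : {x : Fin m → ℝ | tracelessPoint (m + 1) x ∈ tracelessChamber (m + 1)} =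
        ⋂ (i : Fin (m + 1)) (j : Fin (m + 1)) (_ : i ≤ j),
          {x | tracelessPoint (m + 1) x j ≤ tracelessPoint (m + 1) x i} := by
      ext x
      simp only [Set.mem_ofPred_eq, Set.mem_iInter, tracelessPoint_mem_tracelessChamber_iff]
      exact ⟨fun h i j hij => h hij, fun h i j hij => h i j hij⟩
    rw [this]
    refine (isClosed_iInter fun i => isClosed_iInter fun j => isClosed_iInter fun _ =>
      isClosed_le ?_ ?_).measurableSet
    · exact (continuous_apply j).comp continuous_tracelessPoint
    · exact (continuous_apply i).comp continuous_tracelessPoint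
  exact (integral_indicator hmeas).symm

end StepFunction

theorem theorem2 (β : ℝ) (hβ : 0 < β) (d : ℕ) (hd : 0 < d) :
    Asymptotics.IsEquivalent Filter.atTop
      (fun n : ℕ => ∑ μ ∈ partitionsOfLengthLE n d, (numStandardTableaux μ : ℝ) ^ β)
      (fun n : ℕ =>
        ((2 * Real.pi) ^ (-(((d : ℝ) - 1) / 2)) * (d : ℝ) ^ ((n : ℝ) + (d : ℝ) ^ 2 / 2) *
            (n : ℝ) ^ (-(((d : ℝ) - 1) * ((d : ℝ) + 2) / 4))) ^ β *
          (n : ℝ) ^ (((d : ℝ) - 1) / 2) * chamberIntegral d β) := by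
  obtain ⟨m, rfl⟩ : ∃ m, d = m + 1 := ⟨d - 1, by omega⟩
  have hlim : Asymptotics.IsEquivalent atTop (fun n => ∫ x, stepDensity m β n x)
      (fun _ => chamberIntegral (m + 1) β) := by
    rw [chamberIntegral_eq_integral_limitDensity]
    exact (Asymptotics.isEquivalent_const_iff_tendsto (integral_limitDensity_pos hβ).ne').2
      (integrable_limitDensity_and_tendsto hβ).2
  have h := (Asymptotics.IsEquivalent.refl (l := atTop) (u := fun n : ℕ =>
    growthFactor (m + 1) n ^ β * (n : ℝ) ^ ((((m + 1 : ℕ) : ℝ) - 1) / 2))).mul hlim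
  refine h.congr_left ?_
  filter_upwards [eventually_gt_atTop 0] with n hn
  rw [sum_rpow_eq_integral β hn]
  simp
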